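/- **Corollary E.** Let $A \subseteq \mathbb{R}^d$. Here $\lfloor A \rfloor$ is the set of points of $A$ rounded down in each coordinate. For $\alpha \ge 0$ put $$D^{*}_{\alpha}(A) = \limsup_{\|C\| \to \infty} \frac{|\lfloor A \rfloor \cap C|}{\|C\|^{\alpha}}, \qquad \overline{D}_{\alpha}(A) = \limsup_{\ell \to \infty} \frac{|\lfloor A \rfloor \cap [-\ell,\ell)^d|}{(2\ell)^{\alpha}},$$ where the first limit superior is over all cubes $C = \prod_{i=1}^d [a_i, a_i + \|C\|)$ in $\mathbb{R}^d$ as the side length $\|C\|$ tends to infinity. The counting and mass dimensions are $\operatorname{cdim}(A) = \inf\{\alpha \ge 0 : D^{*}_{\alpha}(A) = 0\}$ and $\operatorname{mdim}(A) = \inf\{\alpha \ge 0 : \overline{D}_{\alpha}(A) = 0\}$. The set $A$ is counting regular if $0 < D^{*}_{\operatorname{cdim}(A)}(A) < \infty$, and mass regular if $0 < \overline{D}_{\operatorname{mdim}(A)}(A) < \infty$. Suppose that $\operatorname{cdim}(A) = \operatorname{mdim}(A)$, and let $0 \le k \le d$ be an integer. Then for almost every orthogonal projection $U$ of $\mathbb{R}^d$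 with range of dimension $k$, $$\operatorname{mdim}(UA) = \min\big(k, \operatorname{mdim}(A)\big),$$ and, if $A$ is counting regular and mass regular and $\operatorname{mdim}(A) \ne k$, then $\overline{D}_{\min(k, \operatorname{mdim}(A))}(UA) > 0$. Here "almost every" refers to the $O(d)$-invariant Borel probability measure on the Grassmannian $G(d,k)$ of $k$-dimensional linear subspaces of $\mathbb{R}^d$, under the correspondence of $U$ with its range. -/

import Mathlib

open Filter MeasureTheory
open scoped ENNReal

namespace Marstrand

/-! ## Counting and mass measures and dimensions -/

/-- `ℝ^d` with its Euclidean inner product. -/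
abbrev Euc (d : ℕ) : Type := EuclideanSpace ℝ (Fin d)

/-- The half-open cube `∏ i, [a i, a i + ℓ)` based at `a` with side length `ℓ`. -/
def cube {d : ℕ} (a : Euc d) (ℓ : ℝ) : Set (Euc d) :=
  {x | ∀ i, a i ≤ x i ∧ x i < a i + ℓ}

/-- The cube `[-ℓ, ℓ)^d`, of side length `2 ℓ`. -/
def centeredCube (d : ℕ) (ℓ : ℝ) : Set (Euc d) :=
  {x | ∀ i, -ℓ ≤ x i ∧ x i < ℓ}

/-- The point `x` rounded down in each coordinate. -/
noncomputable def floorVec {d : ℕ} (x : Euc d) : Euc d :=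
  WithLp.toLp 2 (fun i => ((⌊x i⌋ : ℤ) : ℝ))

/-- `⌊A⌋`: the set of all points of `A`, rounded down in each coordinate. -/
def floorSet {d : ℕ} (A : Set (Euc d)) : Set (Euc d) := floorVec '' A

/-- The `α`-counting measure: the limit superior of `|⌊A⌋ ∩ C| / ‖C‖ ^ α` over all cubes `C`
as the side length `‖C‖` tends to infinity. A cube is given by its base point and side length. -/
noncomputable def countingMeas {d : ℕ} (α : ℝ) (A : Set (Euc d)) : ℝ≥0∞ :=
  limsup (fun c : Euc d × ℝ =>
      (((floorSet A ∩ cube c.1 c.2).encard : ℕ∞) : ℝ≥0∞) / ENNReal.ofReal (c.2 ^ α))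
    (comap Prod.snd atTop)

/-- The `α`-mass measure: the limit superior of `|⌊A⌋ ∩ [-ℓ, ℓ)^d| / (2 ℓ) ^ α` as `ℓ → ∞`. -/
noncomputable def massMeas {d : ℕ} (α : ℝ) (A : Set (Euc d)) : ℝ≥0∞ :=
  limsup (fun ℓ : ℝ =>
      (((floorSet A ∩ centeredCube d ℓ).encard : ℕ∞) : ℝ≥0∞) / ENNReal.ofReal ((2 * ℓ) ^ α))
    atTop

/-- The counting dimension. -/
noncomputable def countingDim {d : ℕ} (A : Set (Euc d)) : ℝ :=
  sInf {α : ℝ | 0 ≤ α ∧ countingMeas α A = 0}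

/-- The (upper) mass dimension. -/
noncomputable def massDim {d : ℕ} (A : Set (Euc d)) : ℝ :=
  sInf {α : ℝ | 0 ≤ α ∧ massMeas α A = 0}

/-- `A` is counting regular if its counting measure in its counting dimension is positive and
finite. -/
def IsCountingRegular {d : ℕ} (A : Set (Euc d)) : Prop :=
  0 < countingMeas (countingDim A) A ∧ countingMeas (countingDim A) A < ∞

/-- `A` is mass regular if its mass measure in its mass dimension is positive and finite. -/
def IsMassRegular {d : ℕ} (A : Set (Euc d)) : Prop :=
  0 < massMeas (massDim A) A ∧ massMeas (massDim A) A < ∞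

/-! ## The Grassmannian and its invariant probability measure -/

/-- The orthogonal group `O(d)`, as the group of linear operators on `ℝ^d` whose adjoint is their
inverse, with the topology and Borel structure of the operator norm. -/
abbrev OrthGroup (d : ℕ) : Type := unitary (Euc d →L[ℝ] Euc d)

instance instContinuousStarEuc (d : ℕ) : ContinuousStar (Euc d →L[ℝ] Euc d) :=
  ⟨(ContinuousLinearMap.adjoint (𝕜 := ℝ) (E := Euc d) (F := Euc d)).continuous⟩

instance instIsTopologicalGroupOrthGroup (d : ℕ) : IsTopologicalGroup (OrthGroup d) where
  continuous_mul := continuous_mul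
  continuous_inv := continuous_star

instance instCompactSpaceOrthGroup (d : ℕ) : CompactSpace (OrthGroup d) := by
  suffices h : IsCompact ((unitary (Euc d →L[ℝ] Euc d) : Submonoid _) : Set (Euc d →L[ℝ] Euc d)) from
    isCompact_iff_compactSpace.mp h
  refine Metric.isCompact_of_isClosed_isBounded ?_ ?_
  · exact isClosed_unitary
  · refine (Metric.isBounded_closedBall (x := (0 : Euc d →L[ℝ] Euc d)) (r := 1)).subset ?_
    intro T hT
    rw [mem_closedBall_zero_iff]
    refine ContinuousLinearMap.opNorm_le_bound _ zero_le_one fun x => ?_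
    have := Unitary.norm_map (⟨T, hT⟩ : OrthGroup d) x
    rw [one_mul]
    exact this.le

/-- Haar probability measure on `O(d)`. -/
noncomputable def orthHaar (d : ℕ) : Measure (OrthGroup d) :=
  Measure.haarMeasure (⊤ : TopologicalSpace.PositiveCompacts (OrthGroup d))

/-- The Grassmannian `G(d, k)` of `k`-dimensional linear subspaces of `ℝ^d`. -/
def Grassmannian (d k : ℕ) : Type :=
  {V : Submodule ℝ (Euc d) // Module.finrank ℝ V = k}

/-- The orthogonal projection `U : ℝ^d → ℝ^d` with range `V`. -/
noncomputable def orthProj {d k : ℕ} (V : Grassmannian d k) : Euc d →L[ℝ] Euc d :=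
  V.1.starProjection

/-- The usual topology of `G(d, k)`, given by the metric `‖P_V - P_W‖`: it identifies `G(d, k)`
with the space of orthogonal projections of rank `k` under the operator norm. -/
noncomputable instance instTopologicalSpaceGrassmannian (d k : ℕ) : TopologicalSpace (Grassmannian d k) :=
  TopologicalSpace.induced orthProj inferInstance

noncomputable instance instMeasurableSpaceGrassmannian (d k : ℕ) : MeasurableSpace (Grassmannian d k) :=
  borel _

instance instBorelSpaceGrassmannian (d k : ℕ) : BorelSpace (Grassmannian d k) := ⟨rfl⟩

/-- An element of `O(d)` as a linear automorphism of `ℝ^d`. -/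
noncomputable def orthEquiv {d : ℕ} (g : OrthGroup d) : Euc d ≃ₗᵢ[ℝ] Euc d :=
  Unitary.linearIsometryEquiv g

/-- The action of `O(d)` on `G(d, k)`: `g • V` is the image of `V` under `g`. -/
noncomputable def rotate {d k : ℕ} (g : OrthGroup d) (V : Grassmannian d k) : Grassmannian d k :=
  ⟨V.1.map (orthEquiv g).toLinearEquiv.toLinearMap,
    ((orthEquiv g).toLinearEquiv.finrank_map_eq V.1).trans V.2⟩

/-- The coordinate subspace `ℝ^k × {0}^(d-k)`. -/
noncomputable def coordSubspace (d k : ℕ) (hk : k ≤ d) : Grassmannian d k :=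
  ⟨Submodule.span ℝ (Set.range fun i : Fin k => EuclideanSpace.single (Fin.castLE hk i) (1 : ℝ)), by
    have h : LinearIndependent ℝ
        (fun i : Fin k => EuclideanSpace.single (Fin.castLE hk i) (1 : ℝ)) := by
      have h0 := (EuclideanSpace.orthonormal_single (𝕜 := ℝ) (ι := Fin d)).linearIndependent
      exact h0.comp (Fin.castLE hk) (Fin.castLE_injective hk)
    simpa using finrank_span_eq_card h⟩

/-- The `O(d)`-invariant probability measure `γ_{d,k}` on `G(d, k)`: the distribution of
`g (ℝ^k × {0}^(d-k))` for a Haar-random `g` in `O(d)`. -/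
noncomputable def grassmannMeasure (d k : ℕ) (hk : k ≤ d) : Measure (Grassmannian d k) :=
  (orthHaar d).map fun g => rotate g (coordSubspace d k hk)

lemma orthProj_rotate {d k : ℕ} (g : OrthGroup d) (V : Grassmannian d k) :
    orthProj (rotate g V) = (g : Euc d →L[ℝ] Euc d) * orthProj V * star (g : Euc d →L[ℝ] Euc d) := by
  ext1 x
  have h := Submodule.starProjection_map_apply (orthEquiv g) V.1 x
  exact h

lemma continuous_rotate_left {d k : ℕ} (V : Grassmannian d k) :
    Continuous fun g : OrthGroup d => rotate g V := by
  rw [continuous_induced_rng]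
  have : (orthProj ∘ fun g : OrthGroup d => rotate g V) = fun g : OrthGroup d =>
      (g : Euc d →L[ℝ] Euc d) * orthProj V * star (g : Euc d →L[ℝ] Euc d) :=
    funext fun g => orthProj_rotate g V
  rw [this]
  fun_prop

lemma continuous_rotate_right {d k : ℕ} (g : OrthGroup d) :
    Continuous (rotate g : Grassmannian d k → Grassmannian d k) := by
  rw [continuous_induced_rng]
  have : (orthProj ∘ (rotate g : Grassmannian d k → Grassmannian d k)) = fun V =>
      (g : Euc d →L[ℝ] Euc d) * orthProj V * star (g : Euc d →L[ℝ] Euc d) :=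
    funext fun V => orthProj_rotate g V
  rw [this]
  have h : Continuous (orthProj : Grassmannian d k → _) := continuous_induced_dom
  fun_prop

instance instIsProbabilityMeasureOrthHaar (d : ℕ) : IsProbabilityMeasure (orthHaar d) :=
  ⟨by
    have h := Measure.haarMeasure_self (G := OrthGroup d)
      (K₀ := (⊤ : TopologicalSpace.PositiveCompacts (OrthGroup d)))
    simpa [orthHaar] using h⟩

instance instIsProbabilityMeasureGrassmann (d k : ℕ) (hk : k ≤ d) :
    IsProbabilityMeasure (grassmannMeasure d k hk) :=
  Measure.isProbabilityMeasure_map (continuous_rotate_left _).measurable.aemeasurable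

/-- `γ_{d,k}` is invariant under the action of `O(d)`. -/
lemma grassmannMeasure_map_rotate (d k : ℕ) (hk : k ≤ d) (g : OrthGroup d) :
    (grassmannMeasure d k hk).map (rotate g) = grassmannMeasure d k hk := by
  have h1 : (orthHaar d).map (fun x => g * x) = orthHaar d := by
    unfold orthHaar
    exact map_mul_left_eq_self _ g
  have h2 : (rotate g ∘ fun x => rotate x (coordSubspace d k hk)) =
      (fun x => rotate x (coordSubspace d k hk)) ∘ fun x => g * x := by
    funext x
    apply Subtype.ext
    simp only [rotate, Function.comp, ← Submodule.map_comp]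
    congr 1
  unfold grassmannMeasure
  rw [Measure.map_map (continuous_rotate_right g).measurable (continuous_rotate_left _).measurable,
    h2, ← Measure.map_map (continuous_rotate_left _).measurable (by fun_prop), h1]

end Marstrand

namespace Marstrand

/-! ## Small-ball estimate for random projections -/

/-! Everything rests on one estimate: a random projection of rank `k` sends a vector of length at
least `r` to length at most `t` with probability `O((t/r)^k)`
(`exists_grassmannMeasure_norm_orthProj_le`). The counting dimension supplies growth `ℓ^s` of `⌊A⌋`
in cubes, uniformly in their position. Split space into dyadic shells about a point `x`: the shell
at distance `2^i` holds `O(2^(is))` points of `⌊A⌋`, each projected near the image of `x` with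
probability `O(2^(-ik))`. The expected number of such points is thus a geometric sum of ratio
`2^(s-k)`, which is why `s ≠ k` is imposed.

Lower bound. With `x` ranging over the points of `⌊A⌋` in a cube of side `2ℓ`, the sum is
`O(ℓ^max(s-k,0))` and bounds the expected collisions. By Markov's inequality and Cauchy–Schwarz, few
collisions force a large image: if the cube holds at least `c ℓ^β` points, the image has order `ℓ^(β
- max(s-k,0))` with probability at least `1 - 1/K`. This happens at arbitrarily large scales, so
letting `K → ∞` gives positive mass almost surely (`ae_massMeas_orthProj_pos`).

Upper bound. The bound by `k` holds for every projection. If `s < k`, take `x = 0`: on average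
`O(t^s)` points of `⌊A⌋` are projected into a ball of radius of order `t`. Summing over dyadic `t`
with weights `t^(-s')`, `s' > s`, gives an integrable function, finite almost everywhere
(`ae_massDim_orthProj_le`).

Equality of the two dimensions lets `s` and `β` both approach `mdim A`; regularity lets both equal
it. -/

lemma abs_apply_le_norm_orthProj_coordSubspace {d k : ℕ} (hk : k ≤ d) (y : Euc d) (i : Fin k) :
    |y (Fin.castLE hk i)| ≤ ‖orthProj (coordSubspace d k hk) y‖ := by
  set e : Euc d := EuclideanSpace.single (Fin.castLE hk i) (1 : ℝ) with he
  have hmem : e ∈ (coordSubspace d k hk).1 := Submodule.subset_span ⟨i, rfl⟩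
  have h1 : y (Fin.castLE hk i) = inner ℝ e y := by
    simp [he, EuclideanSpace.inner_single_left]
  have h2 : inner ℝ e y = inner ℝ e (orthProj (coordSubspace d k hk) y) := by
    unfold orthProj
    rw [← Submodule.inner_starProjection_left_eq_right,
      Submodule.starProjection_eq_self_iff.mpr hmem]
  have h3 : ‖e‖ = 1 := by simp [he]
  calc |y (Fin.castLE hk i)| ≤ ‖e‖ * ‖orthProj (coordSubspace d k hk) y‖ := by
        rw [h1, h2]; exact abs_real_inner_le_norm _ _
    _ = _ := by rw [h3, one_mul]

/-- The set lies in a box with `k` half-sides `t` and `d - k` half-sides `1`. -/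
lemma volume_ball_inter_slab_le {d k : ℕ} (hk : k ≤ d) {t : ℝ} (ht : 0 ≤ t) :
    volume {y : Euc d | ‖y‖ < 1 ∧ ‖orthProj (coordSubspace d k hk) y‖ ≤ t} ≤
      ENNReal.ofReal (2 ^ d * t ^ k) := by
  set b : Fin d → ℝ := fun j => if (j : ℕ) < k then t else 1 with hb
  have hb0 : ∀ j, 0 ≤ b j := fun j => by
    simp only [hb]; split_ifs <;> linarith
  have hsub : {y : Euc d | ‖y‖ < 1 ∧ ‖orthProj (coordSubspace d k hk) y‖ ≤ t} ⊆
      (WithLp.ofLp : Euc d → (Fin d → ℝ)) ⁻¹' (Set.univ.pi fun j => Set.Icc (-b j) (b j)) := by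
    rintro y ⟨hy1, hy2⟩ j -
    rw [Set.mem_Icc, ← abs_le]
    simp only [hb]
    split_ifs with hj
    · exact (abs_apply_le_norm_orthProj_coordSubspace hk y ⟨j, hj⟩).trans hy2
    · exact (PiLp.norm_apply_le y j).trans hy1.le
  refine (measure_mono hsub).trans ?_
  rw [(PiLp.volume_preserving_ofLp (Fin d)).measure_preimage
    (MeasurableSet.univ_pi fun j => measurableSet_Icc).nullMeasurableSet, volume_pi_pi]
  simp only [Real.volume_Icc]
  rw [← ENNReal.ofReal_prod_of_nonneg (fun j _ => by linarith [hb0 j])]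
  refine ENNReal.ofReal_le_ofReal (le_of_eq ?_)
  have : ∀ j, b j - -b j = 2 * b j := fun j => by ring
  simp only [this, Finset.prod_mul_distrib, Finset.prod_const, Finset.card_univ, Fintype.card_fin]
  congr 1
  simp [hb, Finset.prod_ite, Fin.card_filter_val_lt, min_eq_right hk]

lemma norm_orthProj_rotate {d k : ℕ} (g : OrthGroup d) (V : Grassmannian d k) (x : Euc d) :
    ‖orthProj (rotate g V) x‖ = ‖orthProj V ((star g : OrthGroup d).1 x)‖ := by
  rw [orthProj_rotate]
  exact Unitary.norm_map g _

/-- The Haar measure of the set of rotations taking `x` close to the kernel of the projection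
onto the coordinate subspace. -/
noncomputable def slabHaar (d k : ℕ) (hk : k ≤ d) (t : ℝ) (x : Euc d) : ℝ≥0∞ :=
  orthHaar d {g | ‖orthProj (coordSubspace d k hk) ((star g : OrthGroup d).1 x)‖ ≤ t * ‖x‖}

/-- Left invariance of Haar measure: replacing `g` by `h * g` cancels the rotation `h` of the
vector. -/
lemma slabHaar_map {d k : ℕ} (hk : k ≤ d) (t : ℝ) (h : OrthGroup d) (x : Euc d) :
    slabHaar d k hk t (h.1 x) = slabHaar d k hk t x := by
  have h1 : MeasurePreserving (fun g : OrthGroup d => h * g) (orthHaar d) (orthHaar d) :=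
    ⟨by fun_prop, by unfold orthHaar; exact map_mul_left_eq_self _ _⟩
  unfold slabHaar
  rw [← h1.measure_preimage]
  · congr 1
    ext g
    simp only [Set.mem_ofPred_eq, Set.preimage]
    rw [Unitary.norm_map h x]
    have h2 : (star g : OrthGroup d) = star (h * g) * h := by
      rw [star_mul, mul_assoc, Unitary.star_mul_self, mul_one]
    have h3 : (star g : OrthGroup d).1 x = (star (h * g) : OrthGroup d).1 (h.1 x) := by
      rw [h2]; rfl
    rw [h3]
  · refine (IsClosed.measurableSet ?_).nullMeasurableSet
    refine isClosed_le ?_ continuous_const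
    have : Continuous fun g : OrthGroup d => (star g : OrthGroup d).1 :=
      continuous_subtype_val.comp continuous_star
    exact ((orthProj _).continuous.comp (this.clm_apply continuous_const)).norm

lemma slabHaar_smul {d k : ℕ} (hk : k ≤ d) (t : ℝ) {c : ℝ} (hc : 0 < c) (x : Euc d) :
    slabHaar d k hk t (c • x) = slabHaar d k hk t x := by
  unfold slabHaar
  congr 1
  ext g
  simp only [Set.mem_ofPred_eq, map_smul, norm_smul, Real.norm_eq_abs, abs_of_pos hc]
  rw [mul_left_comm, mul_le_mul_iff_right₀ hc]

/-- The orthogonal group is transitive on spheres: rescale `x` to the length of `y`, then reflect in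
the hyperplane orthogonal to the difference. -/
lemma slabHaar_eq {d k : ℕ} (hk : k ≤ d) (t : ℝ) {x y : Euc d} (hx : x ≠ 0) (hy : y ≠ 0) :
    slabHaar d k hk t x = slabHaar d k hk t y := by
  have hx' := norm_pos_iff.mpr hx
  have hy' := norm_pos_iff.mpr hy
  set c := ‖y‖ / ‖x‖ with hc
  have hcpos : 0 < c := div_pos hy' hx'
  have hnorm : ‖c • x‖ = ‖y‖ := by
    rw [norm_smul, Real.norm_eq_abs, abs_of_pos hcpos, hc, div_mul_cancel₀ _ hx'.ne']
  have h1 := Submodule.reflection_sub hnorm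
  rw [← slabHaar_smul hk t hcpos x,
    ← slabHaar_map hk t (Unitary.linearIsometryEquiv.symm ((ℝ ∙ (c • x - y))ᗮ.reflection)) (c • x)]
  congr 1

/-- Since the probability is the same for all nonzero vectors, it may be averaged over the unit
ball. Fubini then fixes the rotation instead, leaving the volume of a slab of the ball. -/
lemma slabHaar_mul_volume_ball_le {d k : ℕ} (hk : k ≤ d) {t : ℝ} (ht : 0 ≤ t) {x : Euc d}
    (hx : x ≠ 0) :
    slabHaar d k hk t x * volume (Metric.ball (0 : Euc d) 1) ≤ ENNReal.ofReal (2 ^ d * t ^ k) := by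
  have : Nontrivial (Euc d) := ⟨x, 0, hx⟩
  set S : Set (Euc d × OrthGroup d) := {p | ‖p.1‖ < 1 ∧
    ‖orthProj (coordSubspace d k hk) ((star p.2 : OrthGroup d).1 p.1)‖ ≤ t * ‖p.1‖} with hS
  have hstar : Continuous fun p : Euc d × OrthGroup d => (star p.2 : OrthGroup d).1 p.1 :=
    (continuous_subtype_val.comp (continuous_star.comp continuous_snd)).clm_apply continuous_fst
  have hSm : MeasurableSet S := by
    refine MeasurableSet.inter
      (isOpen_lt continuous_fst.norm continuous_const).measurableSet ?_
    exact (isClosed_le ((orthProj _).continuous.comp hstar).norm (by fun_prop)).measurableSet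
  have h1 : (volume.prod (orthHaar d)) S =
      slabHaar d k hk t x * volume (Metric.ball (0 : Euc d) 1) := by
    rw [Measure.prod_apply hSm]
    have : ∀ᵐ y : Euc d ∂volume, orthHaar d (Prod.mk y ⁻¹' S) =
        (Metric.ball (0 : Euc d) 1).indicator (fun _ => slabHaar d k hk t x) y := by
      filter_upwards [compl_mem_ae_iff.mpr (measure_singleton (0 : Euc d))] with y hy
      by_cases hy1 : ‖y‖ < 1
      · rw [Set.indicator_of_mem (by simpa using hy1), slabHaar_eq hk t hx hy]
        unfold slabHaar
        congr 1
        ext g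
        simp [hS, hy1]
      · rw [Set.indicator_of_notMem (by simpa using hy1)]
        have : Prod.mk y ⁻¹' S = ∅ := by
          ext g
          simp only [hS, Set.mem_preimage, Set.mem_ofPred_eq, Set.mem_empty_iff_false, iff_false]
          exact fun h => hy1 h.1
        rw [this, measure_empty]
    rw [lintegral_congr_ae this, lintegral_indicator_const Metric.isOpen_ball.measurableSet]
  rw [← h1, Measure.prod_apply_symm hSm]
  have h2 : ∀ g : OrthGroup d, volume ((fun y : Euc d => (y, g)) ⁻¹' S) ≤
      ENNReal.ofReal (2 ^ d * t ^ k) := by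
    intro g
    have h3 : volume ((orthEquiv (star g)) ⁻¹'
        {y : Euc d | ‖y‖ < 1 ∧ ‖orthProj (coordSubspace d k hk) y‖ ≤ t}) =
        volume {y : Euc d | ‖y‖ < 1 ∧ ‖orthProj (coordSubspace d k hk) y‖ ≤ t} := by
      refine (orthEquiv (star g)).measurePreserving.measure_preimage
        (MeasurableSet.inter (isOpen_lt continuous_norm continuous_const).measurableSet
          ?_).nullMeasurableSet
      exact (isClosed_le (orthProj _).continuous.norm continuous_const).measurableSet
    refine le_trans ?_ (h3.le.trans (volume_ball_inter_slab_le hk ht))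
    refine measure_mono fun y hy => ?_
    obtain ⟨hy1, hy2⟩ := hy
    refine ⟨?_, hy2.trans ?_⟩
    · simpa using hy1
    · exact mul_le_of_le_one_right ht (le_of_lt hy1)
  calc ∫⁻ g, volume ((fun y : Euc d => (y, g)) ⁻¹' S) ∂(orthHaar d)
      ≤ ∫⁻ _, ENNReal.ofReal (2 ^ d * t ^ k) ∂(orthHaar d) := lintegral_mono h2
    _ = _ := by simp

lemma isClosed_norm_orthProj_le {d k : ℕ} (x : Euc d) (t : ℝ) :
    IsClosed {V : Grassmannian d k | ‖orthProj V x‖ ≤ t} := by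
  have h : Continuous (orthProj : Grassmannian d k → _) := continuous_induced_dom
  exact isClosed_le (h.clm_apply continuous_const).norm continuous_const

/-- The probability that a random projection contracts `x` by the factor `t / r` is at most a
constant times `(t / r) ^ k`. -/
theorem exists_grassmannMeasure_norm_orthProj_le (d k : ℕ) (hk : k ≤ d) :
    ∃ C : ℝ, 0 < C ∧ ∀ (x : Euc d) (r t : ℝ), 0 < r → r ≤ ‖x‖ → 0 ≤ t →
      grassmannMeasure d k hk {V | ‖orthProj V x‖ ≤ t} ≤ ENNReal.ofReal (C * (t / r) ^ k) := by
  set v := (volume (Metric.ball (0 : Euc d) 1)).toReal with hv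
  have hvpos : 0 < v := ENNReal.toReal_pos
    (Metric.measure_ball_pos volume _ one_pos).ne' measure_ball_lt_top.ne
  refine ⟨2 ^ d / v, by positivity, fun x r t hr hrx ht => ?_⟩
  have hx : x ≠ 0 := norm_pos_iff.mp (hr.trans_le hrx)
  have h1 : grassmannMeasure d k hk {V | ‖orthProj V x‖ ≤ t} ≤ slabHaar d k hk (t / r) x := by
    unfold grassmannMeasure
    rw [Measure.map_apply (continuous_rotate_left _).measurable
      (isClosed_norm_orthProj_le x t).measurableSet]
    refine measure_mono fun g hg => ?_
    simp only [Set.mem_preimage, Set.mem_ofPred_eq, norm_orthProj_rotate] at hg ⊢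
    refine hg.trans ?_
    rw [div_mul_eq_mul_div, le_div_iff₀ hr]
    gcongr
  refine h1.trans ?_
  have h2 := slabHaar_mul_volume_ball_le hk (div_nonneg ht hr.le) hx
  rw [← ENNReal.ofReal_toReal (measure_ball_lt_top (μ := volume) (x := (0 : Euc d)) (r := 1)).ne,
    ← hv] at h2
  rw [← ENNReal.le_div_iff_mul_le (Or.inl (by simpa using hvpos)) (Or.inl ENNReal.ofReal_ne_top),
    ← ENNReal.ofReal_div_of_pos hvpos] at h2
  rwa [div_mul_eq_mul_div]

/-! ## Counting integer points -/

/-- The number of elements of a set, as an extended nonnegative real. -/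
noncomputable def cnt {X : Type*} (S : Set X) : ℝ≥0∞ := ((S.encard : ℕ∞) : ℝ≥0∞)

lemma cnt_mono {X : Type*} {S T : Set X} (h : S ⊆ T) : cnt S ≤ cnt T :=
  ENat.toENNReal_mono (Set.encard_le_encard h)

lemma cnt_coe_finset {X : Type*} (F : Finset X) : cnt (F : Set X) = (F.card : ℝ≥0∞) := by
  simp [cnt]

lemma cnt_image_le {X Y : Type*} (f : X → Y) (S : Set X) : cnt (f '' S) ≤ cnt S :=
  ENat.toENNReal_mono (Set.encard_image_le f S)

lemma cnt_union_le {X : Type*} (S T : Set X) : cnt (S ∪ T) ≤ cnt S + cnt T := by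
  unfold cnt
  rw [← ENat.toENNReal_add]
  exact ENat.toENNReal_mono (Set.encard_union_le S T)

lemma cnt_biUnion_finset_le {X Y : Type*} (F : Finset Y) (T : Y → Set X) {c : ℝ≥0∞}
    (hT : ∀ y ∈ F, cnt (T y) ≤ c) : cnt (⋃ y ∈ F, T y) ≤ c * F.card := by
  classical
  induction F using Finset.induction_on with
  | empty => simp [cnt]
  | insert a F ha ih =>
    rw [Finset.set_biUnion_insert, Finset.card_insert_of_notMem ha]
    refine (cnt_union_le _ _).trans ?_
    push_cast
    rw [mul_add, mul_one, add_comm]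
    exact add_le_add (ih fun y hy => hT y (Finset.mem_insert_of_mem hy))
      (hT a (Finset.mem_insert_self a F))

/-- For infinite `S` the right side must be `⊤`, hence `c` has to be nonzero. -/
lemma cnt_biUnion_le {X Y : Type*} (S : Set Y) (T : Y → Set X) {c : ℝ≥0∞} (hc : 1 ≤ c)
    (hT : ∀ y ∈ S, cnt (T y) ≤ c) : cnt (⋃ y ∈ S, T y) ≤ c * cnt S := by
  rcases S.finite_or_infinite with hS | hS
  · have := cnt_biUnion_finset_le hS.toFinset T (c := c) (by simpa using hT)
    rw [← cnt_coe_finset, hS.coe_toFinset] at this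
    simpa using this
  · have : cnt S = ⊤ := by simp [cnt, hS.encard_eq]
    rw [this, ENNReal.mul_top (zero_lt_one.trans_le hc).ne']
    exact le_top

/-- The integer lattice. -/
def intPoints (d : ℕ) : Set (Euc d) :=
  Set.range fun z : Fin d → ℤ => WithLp.toLp 2 fun i => (z i : ℝ)

lemma countable_intPoints (d : ℕ) : (intPoints d).Countable := Set.countable_range _

lemma floorVec_mem_intPoints {d : ℕ} (x : Euc d) : floorVec x ∈ intPoints d :=
  ⟨fun i => ⌊x i⌋, rfl⟩

lemma floorSet_subset_intPoints {d : ℕ} (A : Set (Euc d)) : floorSet A ⊆ intPoints d := by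
  rintro _ ⟨x, -, rfl⟩
  exact floorVec_mem_intPoints x

lemma norm_le_of_abs_le {d : ℕ} {x : Euc d} {c : ℝ} (h : ∀ i, |x i| ≤ c) : ‖x‖ ≤ d * c := by
  rcases Nat.eq_zero_or_pos d with rfl | hd
  · simp [Subsingleton.elim x 0]
  have hc : 0 ≤ c := (abs_nonneg _).trans (h ⟨0, hd⟩)
  have hd1 : (1 : ℝ) ≤ d := by exact_mod_cast hd
  rw [EuclideanSpace.norm_eq]
  refine Real.sqrt_le_iff.mpr ⟨by positivity, ?_⟩
  calc ∑ i, ‖x i‖ ^ 2 ≤ ∑ _i : Fin d, c ^ 2 := by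
        refine Finset.sum_le_sum fun i _ => ?_
        exact pow_le_pow_left₀ (norm_nonneg _) (h i) 2
    _ = d * c ^ 2 := by simp
    _ ≤ (d * c) ^ 2 := by nlinarith [sq_nonneg c]

lemma abs_sub_floorVec_le {d : ℕ} (x : Euc d) (i : Fin d) : |x i - floorVec x i| ≤ 1 := by
  simp only [floorVec]
  rw [abs_of_nonneg (by linarith [Int.floor_le (x i)])]
  linarith [Int.lt_floor_add_one (x i)]

lemma norm_sub_floorVec_le {d : ℕ} (x : Euc d) : ‖x - floorVec x‖ ≤ d := by
  have := norm_le_of_abs_le (x := x - floorVec x) (c := 1) fun i => abs_sub_floorVec_le x i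
  simpa using this

lemma cnt_intPoints_inter_cube_le {d : ℕ} (a : Euc d) {ℓ : ℝ} (hℓ : 0 ≤ ℓ) :
    cnt (intPoints d ∩ cube a ℓ) ≤ ENNReal.ofReal ((ℓ + 1) ^ d) := by
  classical
  set F : Finset (Fin d → ℤ) := Fintype.piFinset fun i => Finset.Ico ⌈a i⌉ ⌈a i + ℓ⌉ with hF
  have hsub : intPoints d ∩ cube a ℓ ⊆
      (fun z : Fin d → ℤ => (WithLp.toLp 2 fun i => (z i : ℝ) : Euc d)) '' (F : Set _) := by
    rintro _ ⟨⟨z, rfl⟩, hz⟩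
    refine ⟨z, ?_, rfl⟩
    simp only [hF, Finset.mem_coe, Fintype.mem_piFinset, Finset.mem_Ico]
    intro i
    exact ⟨Int.ceil_le.mpr (hz i).1, Int.lt_ceil.mpr (hz i).2⟩
  refine (cnt_mono hsub).trans ((cnt_image_le _ _).trans ?_)
  rw [cnt_coe_finset, ← ENNReal.ofReal_natCast]
  refine ENNReal.ofReal_le_ofReal ?_
  rw [hF, Fintype.card_piFinset]
  push_cast
  calc ∏ i, ((Finset.Ico ⌈a i⌉ ⌈a i + ℓ⌉).card : ℝ) ≤ ∏ _i : Fin d, (ℓ + 1) := by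
        refine Finset.prod_le_prod (fun i _ => by positivity) fun i _ => ?_
        rw [Int.card_Ico]
        have h1 : ⌈a i⌉ ≤ ⌈a i + ℓ⌉ := Int.ceil_mono (by linarith)
        have h2 : ((⌈a i + ℓ⌉ - ⌈a i⌉).toNat : ℝ) = (⌈a i + ℓ⌉ : ℝ) - ⌈a i⌉ := by
          rw [← Int.cast_natCast, Int.toNat_of_nonneg (by omega)]
          push_cast; ring
        rw [h2]
        linarith [Int.ceil_lt_add_one (a i + ℓ), Int.le_ceil (a i)]
    _ = (ℓ + 1) ^ d := by simp

lemma closedBall_subset_cube {d : ℕ} (x : Euc d) (R : ℝ) :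
    Metric.closedBall x R ⊆ cube (x - WithLp.toLp 2 fun _ => R) (2 * R + 1) := by
  intro y hy i
  have h1 : |y i - x i| ≤ R := by
    have := PiLp.norm_apply_le (y - x) i
    rw [mem_closedBall_iff_norm] at hy
    exact this.trans hy
  rw [abs_le] at h1
  simp only [PiLp.sub_apply]
  constructor <;> linarith

lemma cnt_intPoints_inter_closedBall_le {d : ℕ} (x : Euc d) {R : ℝ} (hR : 0 ≤ R) :
    cnt (intPoints d ∩ Metric.closedBall x R) ≤ ENNReal.ofReal ((2 * R + 2) ^ d) := by
  refine (cnt_mono (Set.inter_subset_inter_right _ (closedBall_subset_cube x R))).trans ?_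
  refine (cnt_intPoints_inter_cube_le _ (by positivity)).trans (le_of_eq ?_)
  congr 2; ring

/-- A set of integer points covered by balls of radius `R` has at most a constant times as many
points as there are balls. -/
lemma cnt_le_of_forall_exists_norm_sub_le {d : ℕ} {Y : Type*} {S : Set (Euc d)}
    (hS : S ⊆ intPoints d) (T : Set Y) (f : Y → Euc d) {R : ℝ} (hR : 0 ≤ R)
    (h : ∀ w ∈ S, ∃ y ∈ T, ‖w - f y‖ ≤ R) :
    cnt S ≤ ENNReal.ofReal ((2 * R + 2) ^ d) * cnt T := by
  have hsub : S ⊆ ⋃ y ∈ T, intPoints d ∩ Metric.closedBall (f y) R := by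
    intro w hw
    obtain ⟨y, hy, hwy⟩ := h w hw
    exact Set.mem_biUnion hy ⟨hS hw, mem_closedBall_iff_norm.mpr hwy⟩
  refine (cnt_mono hsub).trans (cnt_biUnion_le _ _ ?_ fun y _ =>
    cnt_intPoints_inter_closedBall_le _ hR)
  rw [ENNReal.one_le_ofReal]
  exact one_le_pow₀ (by linarith)

lemma norm_le_of_mem_centeredCube {d : ℕ} {ℓ : ℝ} {x : Euc d} (hx : x ∈ centeredCube d ℓ) :
    ‖x‖ ≤ d * ℓ :=
  norm_le_of_abs_le fun i => abs_le.mpr ⟨(hx i).1, (hx i).2.le⟩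

lemma centeredCube_eq_cube (d : ℕ) (ℓ : ℝ) :
    centeredCube d ℓ = cube (WithLp.toLp 2 fun _ => -ℓ) (2 * ℓ) := by
  ext x
  simp only [centeredCube, cube, Set.mem_ofPred_eq]
  refine forall_congr' fun i => ?_
  rw [show -ℓ + 2 * ℓ = ℓ by ring]

lemma norm_orthProj_le {d k : ℕ} (V : Grassmannian d k) (x : Euc d) : ‖orthProj V x‖ ≤ ‖x‖ :=
  Submodule.norm_starProjection_apply_le _ _

/-- A projection of rank `k` has counting growth at most `ℓ ^ k`. -/
lemma exists_cnt_floorSet_orthProj_le (d k : ℕ) :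
    ∃ C : ℝ, ∀ (V : Grassmannian d k) (A : Set (Euc d)) (ℓ : ℝ), 1 ≤ ℓ →
      cnt (floorSet (orthProj V '' A) ∩ centeredCube d ℓ) ≤ ENNReal.ofReal (C * ℓ ^ (k : ℝ)) := by
  refine ⟨(2 * (d + k : ℝ) + 2) ^ d * (2 * (d + d + k : ℝ) + 2) ^ k, fun V A ℓ hℓ => ?_⟩
  -- Orthonormal coordinates on `V` let the lattice of `ℝ^k` serve as a net. Rounding costs `d` in
  -- the ambient space and `k` in these coordinates, hence the radius `d + k`.
  set e : V.1 ≃ₗᵢ[ℝ] Euc k := ((stdOrthonormalBasis ℝ V.1).reindex (finCongr V.2)).repr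
  have hℓ0 : 0 ≤ ℓ := by linarith
  have h1 := cnt_le_of_forall_exists_norm_sub_le
    (S := floorSet (orthProj V '' A) ∩ centeredCube d ℓ)
    (Set.inter_subset_left.trans (floorSet_subset_intPoints _))
    (intPoints k ∩ Metric.closedBall 0 (d * ℓ + d + k)) (fun y => (e.symm y : Euc d))
    (R := d + k) (by positivity) ?_
  · refine h1.trans ?_
    refine (mul_le_mul_right (cnt_intPoints_inter_closedBall_le _ (by positivity)) _).trans ?_
    rw [← ENNReal.ofReal_mul (by positivity)]
    refine ENNReal.ofReal_le_ofReal ?_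
    rw [mul_assoc, Real.rpow_natCast, ← mul_pow]
    gcongr
    have : 0 ≤ (d : ℝ) * (ℓ - 1) := mul_nonneg (by positivity) (by linarith)
    have : 0 ≤ (k : ℝ) * (ℓ - 1) := mul_nonneg (by positivity) (by linarith)
    nlinarith
  · rintro _ ⟨⟨_, ⟨a, ha, rfl⟩, rfl⟩, hw⟩
    set p : V.1 := ⟨orthProj V a, Submodule.starProjection_apply_mem _ _⟩ with hp
    have h2 : ‖orthProj V a - floorVec (orthProj V a)‖ ≤ d := norm_sub_floorVec_le _
    have h3 : ‖e p‖ = ‖orthProj V a‖ := by rw [e.norm_map]; rfl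
    have h4 : ‖e p - floorVec (e p)‖ ≤ k := norm_sub_floorVec_le _
    have h5 := norm_le_of_mem_centeredCube hw
    refine ⟨floorVec (e p), ⟨floorVec_mem_intPoints _, ?_⟩, ?_⟩
    · rw [mem_closedBall_zero_iff]
      have h6 : ‖orthProj V a‖ ≤ ‖orthProj V a - floorVec (orthProj V a)‖ +
          ‖floorVec (orthProj V a)‖ := by
        simpa using norm_add_le (orthProj V a - floorVec (orthProj V a)) (floorVec (orthProj V a))
      have h7 : ‖floorVec (e p)‖ ≤ ‖e p - floorVec (e p)‖ + ‖e p‖ := by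
        rw [norm_sub_rev]
        simpa using norm_add_le (floorVec (e p) - e p) (e p)
      linarith
    · have h8 : ‖orthProj V a - (e.symm (floorVec (e p)) : Euc d)‖ ≤ k := by
        have : orthProj V a - (e.symm (floorVec (e p)) : Euc d) =
            ((e.symm (e p - floorVec (e p)) : V.1) : Euc d) := by
          rw [map_sub, e.symm_apply_apply]; rfl
        rw [this]
        exact (e.symm.norm_map _).le.trans h4
      rw [norm_sub_rev] at h2
      have := norm_add_le (floorVec (orthProj V a) - orthProj V a)
        (orthProj V a - (e.symm (floorVec (e p)) : Euc d))
      rw [sub_add_sub_cancel] at this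
      linarith

/-! ## Power bounds and dimensions -/

lemma limsup_div_rpow_eq_zero {X : Type*} {l : Filter X} {u : X → ℝ} (hu : Tendsto u l atTop)
    {F : X → ℝ≥0∞} {C s t : ℝ} (hst : s < t)
    (hF : ∀ᶠ x in l, F x ≤ ENNReal.ofReal (C * u x ^ s)) :
    limsup (fun x => F x / ENNReal.ofReal (u x ^ t)) l = 0 := by
  have h1 : Tendsto (fun x => ENNReal.ofReal (C * u x ^ (-(t - s)))) l (nhds 0) := by
    have := ((tendsto_rpow_neg_atTop (sub_pos.mpr hst)).comp hu).const_mul C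
    simpa using ENNReal.tendsto_ofReal this
  have h2 : Tendsto (fun x => F x / ENNReal.ofReal (u x ^ t)) l (nhds 0) := by
    refine tendsto_of_tendsto_of_tendsto_of_le_of_le' tendsto_const_nhds h1
      (Eventually.of_forall fun _ => zero_le) ?_
    filter_upwards [hF, hu.eventually_gt_atTop 0] with x hx hpos
    refine (ENNReal.div_le_div_right hx _).trans (le_of_eq ?_)
    rw [← ENNReal.ofReal_div_of_pos (Real.rpow_pos_of_pos hpos _), neg_sub,
      Real.rpow_sub hpos, mul_div_assoc]
  rcases l.eq_or_neBot with rfl | hl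
  · simp
  · exact h2.limsup_eq

lemma tendsto_two_mul_atTop : Tendsto (fun ℓ : ℝ => 2 * ℓ) atTop atTop :=
  tendsto_id.const_mul_atTop two_pos

lemma massMeas_eq_zero_of_le {d : ℕ} {B : Set (Euc d)} {C s t : ℝ} (hst : s < t)
    (h : ∀ᶠ ℓ : ℝ in atTop, cnt (floorSet B ∩ centeredCube d ℓ) ≤ ENNReal.ofReal (C * ℓ ^ s)) :
    massMeas t B = 0 := by
  -- The factor `2 ^ (-s)` converts from `ℓ` to the side length `2 * ℓ`.
  refine limsup_div_rpow_eq_zero tendsto_two_mul_atTop (C := C * 2 ^ (-s)) hst ?_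
  filter_upwards [h, eventually_gt_atTop 0] with ℓ hℓ hpos
  refine hℓ.trans (le_of_eq ?_)
  rw [Real.mul_rpow two_pos.le hpos.le, mul_assoc, ← mul_assoc (2 ^ (-s)),
    ← Real.rpow_add two_pos]
  simp

lemma cnt_centeredCube_le {d : ℕ} (B : Set (Euc d)) {ℓ : ℝ} (hℓ : 1 ≤ ℓ) :
    cnt (floorSet B ∩ centeredCube d ℓ) ≤ ENNReal.ofReal (3 ^ d * ℓ ^ (d : ℝ)) := by
  rw [centeredCube_eq_cube]
  refine (cnt_mono (Set.inter_subset_inter_left _ (floorSet_subset_intPoints B))).trans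
    ((cnt_intPoints_inter_cube_le _ (by linarith)).trans (ENNReal.ofReal_le_ofReal ?_))
  rw [Real.rpow_natCast, ← mul_pow]
  exact pow_le_pow_left₀ (by linarith) (by linarith) _

lemma cnt_cube_le {d : ℕ} (B : Set (Euc d)) (a : Euc d) {ℓ : ℝ} (hℓ : 1 ≤ ℓ) :
    cnt (floorSet B ∩ cube a ℓ) ≤ ENNReal.ofReal (2 ^ d * ℓ ^ (d : ℝ)) := by
  refine (cnt_mono (Set.inter_subset_inter_left _ (floorSet_subset_intPoints B))).trans
    ((cnt_intPoints_inter_cube_le _ (by linarith)).trans (ENNReal.ofReal_le_ofReal ?_))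
  rw [Real.rpow_natCast, ← mul_pow]
  exact pow_le_pow_left₀ (by linarith) (by linarith) _

/-- Needed because `sInf ∅ = 0` in `ℝ`; the lattice has growth exponent at most `d`, so `d + 1` is
always admissible. -/
lemma massDim_set_nonempty {d : ℕ} (B : Set (Euc d)) :
    {α : ℝ | 0 ≤ α ∧ massMeas α B = 0}.Nonempty :=
  ⟨d + 1, by positivity, massMeas_eq_zero_of_le (s := d) (by linarith)
    (by filter_upwards [eventually_ge_atTop 1] with ℓ hℓ using cnt_centeredCube_le B hℓ)⟩

lemma countingDim_set_nonempty {d : ℕ} (B : Set (Euc d)) :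
    {α : ℝ | 0 ≤ α ∧ countingMeas α B = 0}.Nonempty := by
  refine ⟨d + 1, by positivity, limsup_div_rpow_eq_zero (u := fun c : Euc d × ℝ => c.2)
    (C := 2 ^ d) (s := d) tendsto_comap (by linarith) ?_⟩
  filter_upwards [tendsto_comap.eventually (eventually_ge_atTop (1 : ℝ))] with c hc
  exact cnt_cube_le B c.1 hc

lemma massDim_nonneg {d : ℕ} (B : Set (Euc d)) : 0 ≤ massDim B :=
  Real.sInf_nonneg fun _ h => h.1

lemma bddBelow_massDim_set {d : ℕ} (B : Set (Euc d)) :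
    BddBelow {α : ℝ | 0 ≤ α ∧ massMeas α B = 0} := ⟨0, fun _ h => h.1⟩

lemma massDim_le_of_le {d : ℕ} {B : Set (Euc d)} {C s : ℝ} (hs : 0 ≤ s)
    (h : ∀ᶠ ℓ : ℝ in atTop, cnt (floorSet B ∩ centeredCube d ℓ) ≤ ENNReal.ofReal (C * ℓ ^ s)) :
    massDim B ≤ s :=
  le_of_forall_gt_imp_ge_of_dense fun _ ht =>
    csInf_le (bddBelow_massDim_set B) ⟨hs.trans ht.le, massMeas_eq_zero_of_le ht h⟩

lemma massMeas_antitone {d : ℕ} (B : Set (Euc d)) : Antitone fun α => massMeas α B := by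
  intro α β hαβ
  refine limsup_le_limsup ?_
  filter_upwards [tendsto_two_mul_atTop.eventually_ge_atTop 1] with ℓ hℓ
  exact ENNReal.div_le_div_left
    (ENNReal.ofReal_le_ofReal (Real.rpow_le_rpow_of_exponent_le hℓ hαβ)) _

lemma le_massDim_of_massMeas_pos {d : ℕ} {B : Set (Euc d)} {β : ℝ} (h : 0 < massMeas β B) :
    β ≤ massDim B := by
  refine le_csInf (massDim_set_nonempty B) fun α hα => ?_
  by_contra! hlt
  have := massMeas_antitone B hlt.le
  simp only [hα.2] at this
  exact absurd (h.trans_le this) (lt_irrefl _)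

lemma massMeas_pos_of_lt_massDim {d : ℕ} {B : Set (Euc d)} {β : ℝ} (hβ : 0 ≤ β)
    (h : β < massDim B) : 0 < massMeas β B := by
  refine pos_iff_ne_zero.mpr fun h0 => ?_
  exact absurd (csInf_le (bddBelow_massDim_set B) ⟨hβ, h0⟩) (not_le.mpr h)

lemma exists_frequently_of_massMeas_pos {d : ℕ} {B : Set (Euc d)} {β : ℝ}
    (h : 0 < massMeas β B) :
    ∃ c : ℝ, 0 < c ∧ ∃ᶠ ℓ : ℝ in atTop,
      ENNReal.ofReal (c * ℓ ^ β) ≤ cnt (floorSet B ∩ centeredCube d ℓ) := by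
  obtain ⟨c, hc0, hc⟩ := ENNReal.lt_iff_exists_nnreal_btwn.mp h
  have hc0' : (0 : ℝ) < c := by simpa using hc0
  refine ⟨c * 2 ^ β, by positivity, ?_⟩
  refine ((frequently_lt_of_lt_limsup (by isBoundedDefault) hc).and_eventually
    (eventually_gt_atTop 0)).mono ?_
  rintro ℓ ⟨h1, hpos⟩
  rw [mul_assoc, ← Real.mul_rpow two_pos.le hpos.le, ENNReal.ofReal_mul hc0'.le,
    ENNReal.ofReal_coe_nnreal]
  exact ENNReal.mul_le_of_le_div h1.le

lemma eventually_lt_of_massMeas_eq_zero {d : ℕ} {B : Set (Euc d)} {γ : ℝ}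
    (h : massMeas γ B = 0) {δ : ℝ} (hδ : 0 < δ) :
    ∀ᶠ ℓ : ℝ in atTop,
      cnt (floorSet B ∩ centeredCube d ℓ) < ENNReal.ofReal (δ * (2 * ℓ) ^ γ) := by
  have h1 : massMeas γ B < ENNReal.ofReal δ := by rw [h]; simpa using hδ
  filter_upwards [eventually_lt_of_limsup_lt h1, eventually_gt_atTop 0] with ℓ h2 hpos
  rw [ENNReal.ofReal_mul hδ.le]
  have h3 : 0 < (2 * ℓ) ^ γ := Real.rpow_pos_of_pos (by linarith) _
  rwa [ENNReal.div_lt_iff (Or.inl (by simpa using h3)) (Or.inl ENNReal.ofReal_ne_top)] at h2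

/-- The filter constrains only the side length, so the bound beyond a threshold `M` is uniform in
the base point. A smaller cube is enlarged to side `M`, and `ℓ ^ s ≥ 1` absorbs the loss. -/
lemma exists_cnt_cube_le_of_countingMeas_lt_top {d : ℕ} {A : Set (Euc d)} {s : ℝ} (hs : 0 ≤ s)
    (h : countingMeas s A < ∞) :
    ∃ C : ℝ, 0 < C ∧ ∀ (a : Euc d) (ℓ : ℝ), 1 ≤ ℓ →
      cnt (floorSet A ∩ cube a ℓ) ≤ ENNReal.ofReal (C * ℓ ^ s) := by
  obtain ⟨c, hc, -⟩ := ENNReal.lt_iff_exists_nnreal_btwn.mp h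
  have h1 := eventually_lt_of_limsup_lt hc
  rw [eventually_comap] at h1
  obtain ⟨L, hL⟩ := eventually_atTop.mp h1
  set M := max L 1 with hM
  have hM1 : 1 ≤ M := le_max_right _ _
  have hbig : ∀ (a : Euc d) (ℓ : ℝ), M ≤ ℓ →
      cnt (floorSet A ∩ cube a ℓ) ≤ ENNReal.ofReal (c * ℓ ^ s) := by
    intro a ℓ hℓ
    have h2 := hL ℓ ((le_max_left _ _).trans hℓ) (a, ℓ) rfl
    have hpos : 0 < ℓ ^ s := Real.rpow_pos_of_pos (by linarith) _
    rw [ENNReal.ofReal_mul c.coe_nonneg, ENNReal.ofReal_coe_nnreal]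
    exact (ENNReal.div_le_iff (by simpa using hpos) ENNReal.ofReal_ne_top).mp h2.le
  refine ⟨c * M ^ s + 1, by positivity, fun a ℓ hℓ => ?_⟩
  have hℓs : 1 ≤ ℓ ^ s := Real.one_le_rpow hℓ hs
  rcases le_total M ℓ with hMl | hMl
  · refine (hbig a ℓ hMl).trans (ENNReal.ofReal_le_ofReal ?_)
    have : (c : ℝ) ≤ c * M ^ s := le_mul_of_one_le_right c.coe_nonneg (Real.one_le_rpow hM1 hs)
    exact mul_le_mul_of_nonneg_right (by linarith) (by linarith)
  · have hsub : cube a ℓ ⊆ cube a M := fun x hx i => ⟨(hx i).1, (hx i).2.trans_le (by linarith)⟩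
    refine (cnt_mono (Set.inter_subset_inter_right _ hsub)).trans
      ((hbig a M le_rfl).trans (ENNReal.ofReal_le_ofReal ?_))
    have : 0 ≤ c * M ^ s := by positivity
    nlinarith

lemma exists_cnt_cube_le_of_countingDim_lt {d : ℕ} {A : Set (Euc d)} {s : ℝ}
    (h : countingDim A < s) :
    ∃ C : ℝ, 0 < C ∧ ∀ (a : Euc d) (ℓ : ℝ), 1 ≤ ℓ →
      cnt (floorSet A ∩ cube a ℓ) ≤ ENNReal.ofReal (C * ℓ ^ s) := by
  obtain ⟨α, ⟨hα0, hα⟩, hαs⟩ := exists_lt_of_csInf_lt (countingDim_set_nonempty A) h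
  obtain ⟨C, hC, hb⟩ := exists_cnt_cube_le_of_countingMeas_lt_top hα0 (by rw [hα]; simp)
  refine ⟨C, hC, fun a ℓ hℓ => (hb a ℓ hℓ).trans (ENNReal.ofReal_le_ofReal ?_)⟩
  exact mul_le_mul_of_nonneg_left (Real.rpow_le_rpow_of_exponent_le hℓ hαs.le) hC.le

/-! ## Dyadic decomposition of sums of small-ball probabilities -/

/-- If `F` has at most `B (2 ^ i) ^ s` points in the ball of radius `2 ^ i t` about `x` for each
`i ≤ m`, then the expected number of points of `F` projected to within `ρ t` of the projection
of `x` is bounded by a geometric sum. -/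
lemma exists_sum_grassmannMeasure_le (d k : ℕ) (hk : k ≤ d) {ρ : ℝ} (hρ : 0 ≤ ρ) :
    ∃ C : ℝ, 0 < C ∧ ∀ (x : Euc d) (F : Finset (Euc d)) (t B s : ℝ) (m : ℕ), 0 < t → 0 ≤ B →
      (∀ i ≤ m, ((F.filter fun z => ‖z - x‖ < 2 ^ i * t).card : ℝ) ≤ B * ((2 : ℝ) ^ s) ^ i) →
      ∑ z ∈ F.filter (fun z => ‖z - x‖ < 2 ^ m * t),
        (grassmannMeasure d k hk).real {V | ‖orthProj V (z - x)‖ ≤ ρ * t} ≤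
      C * B * ∑ i ∈ Finset.range (m + 1), ((2 : ℝ) ^ (s - k)) ^ i := by
  classical
  obtain ⟨C₀, hC₀, hsmall⟩ := exists_grassmannMeasure_norm_orthProj_le d k hk
  -- The `1` pays for the innermost ball, where probabilities are bounded trivially; the `2` appears
  -- because a shell's inner radius is half its outer one.
  refine ⟨1 + C₀ * (2 * ρ) ^ k, by positivity, fun x F t B s m ht hB => ?_⟩
  set p : Euc d → ℝ := fun z =>
    (grassmannMeasure d k hk).real {V | ‖orthProj V (z - x)‖ ≤ ρ * t} with hp
  have hD : 0 ≤ C₀ * (2 * ρ) ^ k := by positivity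
  induction m with
  | zero =>
    intro h
    have h0 := h 0 le_rfl
    simp only [pow_zero, one_mul, mul_one, zero_add, Finset.sum_range_one] at h0 ⊢
    calc ∑ z ∈ F.filter (fun z => ‖z - x‖ < t), p z
        ≤ ∑ z ∈ F.filter (fun z => ‖z - x‖ < t), 1 :=
          Finset.sum_le_sum fun z _ => measureReal_le_one
      _ = ((F.filter (fun z => ‖z - x‖ < t)).card : ℝ) := by simp
      _ ≤ B := h0
      _ ≤ _ := by nlinarith
  | succ m ih =>
    intro h
    have ih' := ih fun i hi => h i (by omega)
    have hlast := h (m + 1) le_rfl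
    rw [Finset.sum_range_succ, mul_add]
    have hsplit : F.filter (fun z => ‖z - x‖ < 2 ^ (m + 1) * t) =
        F.filter (fun z => ‖z - x‖ < 2 ^ m * t) ∪
        (F.filter (fun z => ‖z - x‖ < 2 ^ (m + 1) * t)).filter (fun z => 2 ^ m * t ≤ ‖z - x‖) := by
      ext z
      simp only [Finset.mem_union, Finset.mem_filter]
      have h2 : (2 : ℝ) ^ m * t ≤ 2 ^ (m + 1) * t :=
        mul_le_mul_of_nonneg_right (pow_le_pow_right₀ one_le_two (Nat.le_succ m)) ht.le
      constructor
      · rintro ⟨h3, h4⟩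
        rcases lt_or_ge ‖z - x‖ (2 ^ m * t) with h5 | h5
        · exact Or.inl ⟨h3, h5⟩
        · exact Or.inr ⟨⟨h3, h4⟩, h5⟩
      · rintro (⟨h3, h4⟩ | ⟨h3, -⟩)
        · exact ⟨h3, h4.trans_le h2⟩
        · exact h3
    rw [hsplit, Finset.sum_union (Finset.disjoint_left.mpr fun z h3 h4 =>
      absurd (Finset.mem_filter.mp h3).2 (not_lt.mpr (Finset.mem_filter.mp h4).2))]
    refine add_le_add ih' ?_
    set G := (F.filter (fun z => ‖z - x‖ < 2 ^ (m + 1) * t)).filter (fun z => 2 ^ m * t ≤ ‖z - x‖)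
      with hG
    have hpz : ∀ z ∈ G, p z ≤ C₀ * (ρ / 2 ^ m) ^ k := by
      intro z hz
      have h5 := hsmall (z - x) (2 ^ m * t) (ρ * t) (by positivity) (Finset.mem_filter.mp hz).2
        (by positivity)
      rw [mul_div_mul_right _ _ ht.ne'] at h5
      exact ENNReal.toReal_le_of_le_ofReal (by positivity) h5
    have hGcard : (G.card : ℝ) ≤ B * ((2 : ℝ) ^ s) ^ (m + 1) :=
      le_trans (Nat.cast_le.mpr (Finset.card_filter_le _ _)) hlast
    calc ∑ z ∈ G, p z ≤ G.card • (C₀ * (ρ / 2 ^ m) ^ k) := Finset.sum_le_card_nsmul _ _ _ hpz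
      _ = G.card * (C₀ * (ρ / 2 ^ m) ^ k) := nsmul_eq_mul _ _
      _ ≤ B * ((2 : ℝ) ^ s) ^ (m + 1) * (C₀ * (ρ / 2 ^ m) ^ k) := by gcongr
      _ = C₀ * (2 * ρ) ^ k * B * ((2 : ℝ) ^ (s - k)) ^ (m + 1) := by
        rw [Real.rpow_sub two_pos, Real.rpow_natCast, div_pow, div_pow, mul_pow, ← pow_mul,
          ← pow_mul 2 k, mul_comm k (m + 1), add_mul, one_mul, pow_add, mul_comm m k]
        field_simp
        ring
      _ ≤ (1 + C₀ * (2 * ρ) ^ k) * B * ((2 : ℝ) ^ (s - k)) ^ (m + 1) := by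
        gcongr
        linarith

lemma geom_sum_le_of_lt_one {q : ℝ} (h0 : 0 ≤ q) (h1 : q < 1) (n : ℕ) :
    ∑ i ∈ Finset.range n, q ^ i ≤ 1 / (1 - q) := by
  rw [le_div_iff₀ (by linarith), geom_sum_mul_neg]
  linarith [pow_nonneg h0 n]

lemma geom_sum_le_of_one_lt {q : ℝ} (h1 : 1 < q) (n : ℕ) :
    ∑ i ∈ Finset.range n, q ^ i ≤ q ^ n / (q - 1) := by
  rw [le_div_iff₀ (by linarith), geom_sum_mul]
  linarith

/-- For a set of growth exponent at most `s ≠ k`, the expected number of points of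
`A ∩ [-ℓ, ℓ)^d` projected close to the projection of a given point is `O(ℓ ^ max (s - k) 0)`. -/
lemma exists_sum_grassmannMeasure_sub_le (d k : ℕ) (hk : k ≤ d) {ρ : ℝ} (hρ : 0 ≤ ρ)
    (A : Set (Euc d)) {C s : ℝ} (hC : 0 < C) (hsk : s ≠ k)
    (hA : ∀ (a : Euc d) (ℓ : ℝ), 1 ≤ ℓ →
      cnt (floorSet A ∩ cube a ℓ) ≤ ENNReal.ofReal (C * ℓ ^ s)) :
    ∃ E : ℝ, 0 < E ∧ ∀ (ℓ : ℝ) (F : Finset (Euc d)) (x : Euc d), 1 ≤ ℓ →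
      (F : Set (Euc d)) ⊆ floorSet A → (∀ z ∈ F, z ∈ centeredCube d ℓ) → x ∈ F →
      ∑ z ∈ F, (grassmannMeasure d k hk).real {V | ‖orthProj V (z - x)‖ ≤ ρ} ≤
        E * ℓ ^ max (s - k) 0 := by
  classical
  obtain ⟨C₁, hC₁, hsum⟩ := exists_sum_grassmannMeasure_le d k hk hρ
  set q : ℝ := 2 ^ (s - k) with hq
  have hq0 : 0 < q := by positivity
  have key : ∀ (ℓ : ℝ) (F : Finset (Euc d)) (x : Euc d), 1 ≤ ℓ →
      (F : Set (Euc d)) ⊆ floorSet A → (∀ z ∈ F, z ∈ centeredCube d ℓ) → x ∈ F →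
      ∃ n : ℕ, (2 : ℝ) ^ n ≤ (2 * d + 1) * ℓ ∧
      ∑ z ∈ F, (grassmannMeasure d k hk).real {V | ‖orthProj V (z - x)‖ ≤ ρ} ≤
        C₁ * (C * (3 : ℝ) ^ s) * ∑ i ∈ Finset.range (n + 1 + 1), q ^ i := by
    intro ℓ F x hℓ hFA hFQ hx
    have hdl : (0 : ℝ) ≤ d * ℓ := by positivity
    -- `F` has diameter at most `2dℓ`, so the ball of radius `2 ^ (n + 1)` about `x` contains it
    -- all.
    obtain ⟨n, hn1, hn2⟩ := exists_nat_pow_near (x := 2 * (d * ℓ) + 1) (y := 2)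
      (by linarith) one_lt_two
    refine ⟨n, by nlinarith, ?_⟩
    have hfil : F.filter (fun z => ‖z - x‖ < 2 ^ (n + 1) * 1) = F := by
      refine Finset.filter_true_of_mem fun z hz => ?_
      have h1 := norm_le_of_mem_centeredCube (hFQ z hz)
      have h2 := norm_le_of_mem_centeredCube (hFQ x hx)
      have h3 := norm_sub_le z x
      linarith
    have := hsum x F 1 (C * (3 : ℝ) ^ s) s (n + 1) one_pos (by positivity) ?_
    · rw [hfil] at this
      simpa using this
    · intro i _
      have h1 : ((F.filter fun z => ‖z - x‖ < 2 ^ i * 1 : Finset (Euc d)) : Set (Euc d)) ⊆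
          floorSet A ∩ cube (x - WithLp.toLp 2 fun _ => (2 : ℝ) ^ i) (3 * 2 ^ i) := by
        intro z hz
        rw [Finset.mem_coe, Finset.mem_filter, mul_one] at hz
        refine ⟨hFA hz.1, fun j => ?_⟩
        have h2 : |z j - x j| < 2 ^ i := (PiLp.norm_apply_le (z - x) j).trans_lt hz.2
        rw [abs_lt] at h2
        have h3 : (0 : ℝ) < 2 ^ i := by positivity
        simp only [PiLp.sub_apply]
        constructor <;> linarith
      have h2 : (1 : ℝ) ≤ 2 ^ i := one_le_pow₀ one_le_two
      have h3 := (cnt_mono h1).trans (hA _ _ (by linarith))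
      rw [cnt_coe_finset, ← ENNReal.ofReal_natCast,
        ENNReal.ofReal_le_ofReal_iff (by positivity)] at h3
      refine h3.trans (le_of_eq ?_)
      rw [Real.mul_rpow (by norm_num) (by positivity), ← Real.rpow_natCast_mul two_pos.le,
        ← Real.rpow_mul_natCast two_pos.le, mul_comm (i : ℝ) s]
      ring
  rcases lt_or_gt_of_ne hsk with h | h
  · have hq1 : q < 1 := Real.rpow_lt_one_of_one_lt_of_neg one_lt_two (by linarith)
    have : 0 < 1 - q := by linarith
    refine ⟨C₁ * (C * (3 : ℝ) ^ s) * (1 / (1 - q)), by positivity, ?_⟩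
    intro ℓ F x hℓ hFA hFQ hx
    obtain ⟨n, -, hn⟩ := key ℓ F x hℓ hFA hFQ hx
    rw [max_eq_right (by linarith), Real.rpow_zero, mul_one]
    refine hn.trans ?_
    gcongr
    exact geom_sum_le_of_lt_one hq0.le hq1 _
  · have hq1 : 1 < q := Real.one_lt_rpow one_lt_two (by linarith)
    have : 0 < q - 1 := by linarith
    refine ⟨C₁ * (C * (3 : ℝ) ^ s) * (q ^ 2 * (2 * d + 1) ^ (s - k) / (q - 1)), by positivity, ?_⟩
    intro ℓ F x hℓ hFA hFQ hx
    obtain ⟨n, hn1, hn⟩ := key ℓ F x hℓ hFA hFQ hx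
    rw [max_eq_left (by linarith)]
    refine hn.trans ?_
    rw [mul_assoc _ (_ / _)]
    gcongr
    refine (geom_sum_le_of_one_lt hq1 _).trans ?_
    rw [div_mul_eq_mul_div]
    gcongr
    have h1 : q ^ (n + 1 + 1) = q ^ 2 * ((2 : ℝ) ^ n) ^ (s - k) := by
      rw [hq, ← Real.rpow_natCast_mul two_pos.le, mul_comm (n : ℝ), Real.rpow_mul_natCast two_pos.le]
      ring
    rw [h1, mul_assoc, ← Real.mul_rpow (by positivity) (by linarith)]
    gcongr

/-! ## Lower bound for the mass of random projections -/

/-- Cauchy–Schwarz: few collisions force a large image. -/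
lemma card_sq_le_card_image_mul {X Y : Type*} [DecidableEq Y] (F : Finset X) (g : X → Y) :
    F.card ^ 2 ≤ (F.image g).card * ∑ z ∈ F, (F.filter fun w => g w = g z).card := by
  have h1 : F.card = ∑ b ∈ F.image g, (F.filter fun w => g w = b).card :=
    Finset.card_eq_sum_card_image g F
  have h2 : ∑ z ∈ F, (F.filter fun w => g w = g z).card =
      ∑ b ∈ F.image g, (F.filter fun w => g w = b).card ^ 2 := by
    rw [← Finset.sum_fiberwise_of_maps_to (fun z hz => Finset.mem_image_of_mem g hz)]
    refine Finset.sum_congr rfl fun b _ => ?_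
    rw [sq, ← smul_eq_mul, ← Finset.sum_const]
    refine Finset.sum_congr rfl fun z hz => ?_
    rw [(Finset.mem_filter.mp hz).2]
  rw [h2]
  conv_lhs => rw [h1]
  exact sq_sum_le_card_mul_sum_sq

/-- Markov's inequality for the number of near-colliding pairs, whose expectation is at most `F.card
* M`. -/
lemma grassmannMeasure_le_sum_card_filter_le {d k : ℕ} (hk : k ≤ d) {ρ : ℝ}
    {F : Finset (Euc d)} (hF : F.Nonempty) {M : ℝ}
    (h : ∀ x ∈ F, ∑ z ∈ F, (grassmannMeasure d k hk).real {V | ‖orthProj V (z - x)‖ ≤ ρ} ≤ M)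
    {K : ℝ} (hK : 0 < K) (hM : 0 < M) :
    grassmannMeasure d k hk {V | K * (F.card * M) ≤
      ∑ x ∈ F, ((F.filter fun z => ‖orthProj V (z - x)‖ ≤ ρ).card : ℝ)} ≤ ENNReal.ofReal (1 / K) := by
  classical
  set μ := grassmannMeasure d k hk
  set S : Euc d → Set (Grassmannian d k) := fun y => {V | ‖orthProj V y‖ ≤ ρ} with hS
  have hSm : ∀ y, MeasurableSet (S y) := fun y => (isClosed_norm_orthProj_le y ρ).measurableSet
  set f : Grassmannian d k → ℝ≥0∞ := fun V =>
    ∑ x ∈ F, ∑ z ∈ F, (S (z - x)).indicator (fun _ => (1 : ℝ≥0∞)) V with hf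
  have hfm : Measurable f := by
    refine Finset.measurable_sum _ fun x _ => Finset.measurable_sum _ fun z _ => ?_
    exact measurable_const.indicator (hSm _)
  have hint : ∫⁻ V, f V ∂μ ≤ ENNReal.ofReal (F.card * M) := by
    rw [lintegral_finsetSum _ fun x _ => Finset.measurable_sum _ fun z _ =>
      measurable_const.indicator (hSm _)]
    have h1 : ∀ x ∈ F, ∫⁻ V, ∑ z ∈ F, (S (z - x)).indicator (fun _ => (1 : ℝ≥0∞)) V ∂μ ≤
        ENNReal.ofReal M := by
      intro x hx
      rw [lintegral_finsetSum _ fun z _ => measurable_const.indicator (hSm _)]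
      simp only [lintegral_indicator_const (hSm _), one_mul]
      refine le_trans (le_of_eq ?_) (ENNReal.ofReal_le_ofReal (h x hx))
      rw [ENNReal.ofReal_sum_of_nonneg fun z _ => measureReal_nonneg]
      exact Finset.sum_congr rfl fun z _ => by simp [S, μ]
    refine (Finset.sum_le_card_nsmul _ _ _ h1).trans (le_of_eq ?_)
    rw [nsmul_eq_mul, ENNReal.ofReal_mul (by positivity), ENNReal.ofReal_natCast]
  have hcard : (0 : ℝ) < F.card := by exact_mod_cast hF.card_pos
  have hfV : ∀ V, f V =
      ENNReal.ofReal (∑ x ∈ F, ((F.filter fun z => ‖orthProj V (z - x)‖ ≤ ρ).card : ℝ)) := by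
    intro V
    rw [ENNReal.ofReal_sum_of_nonneg fun x _ => by positivity]
    refine Finset.sum_congr rfl fun x _ => ?_
    rw [ENNReal.ofReal_natCast, Finset.card_filter]
    push_cast
    refine Finset.sum_congr rfl fun z _ => ?_
    simp [S, Set.indicator_apply]
  have hmarkov := mul_meas_ge_le_lintegral (μ := μ) hfm (ENNReal.ofReal (K * (F.card * M)))
  have hsub : {V | K * (F.card * M) ≤
      ∑ x ∈ F, ((F.filter fun z => ‖orthProj V (z - x)‖ ≤ ρ).card : ℝ)} ⊆
      {V | ENNReal.ofReal (K * (F.card * M)) ≤ f V} := by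
    intro V hV
    rw [Set.mem_ofPred_eq, hfV]
    exact ENNReal.ofReal_le_ofReal hV
  refine (measure_mono hsub).trans ?_
  have h2 := hmarkov.trans hint
  rw [mul_comm, ← ENNReal.le_div_iff_mul_le (Or.inl (by simpa using by positivity))
    (Or.inl ENNReal.ofReal_ne_top), ← ENNReal.ofReal_div_of_pos (by positivity)] at h2
  refine h2.trans (le_of_eq ?_)
  congr 1
  field_simp

/-- If the points of `⌊A⌋` in `F` have few near-collisions under `P_V`, then `⌊P_V A⌋` is large. -/
lemma card_sq_le_cnt_floorSet_orthProj {d k : ℕ} (V : Grassmannian d k) (A : Set (Euc d))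
    (F : Finset (Euc d)) {ℓ : ℝ} (hℓ : 1 ≤ ℓ) (hFA : (F : Set (Euc d)) ⊆ floorSet A)
    (hFQ : ∀ z ∈ F, z ∈ centeredCube d ℓ) :
    ∃ D : ℕ, (D : ℝ≥0∞) ≤ cnt (floorSet (orthProj V '' A) ∩ centeredCube d ((3 * d + 1) * ℓ)) ∧
      (F.card : ℝ) ^ 2 ≤ D * ∑ x ∈ F, ((F.filter fun z => ‖orthProj V (z - x)‖ ≤ 4 * d).card : ℝ) := by
  classical
  have hch : ∀ z : Euc d, ∃ a : Euc d, z ∈ F → a ∈ A ∧ floorVec a = z := by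
    intro z
    by_cases hz : z ∈ F
    · obtain ⟨a, ha, rfl⟩ := hFA hz
      exact ⟨a, fun _ => ⟨ha, rfl⟩⟩
    · exact ⟨0, fun h => absurd h hz⟩
  choose a ha using hch
  -- Passing from `z` to a preimage `a z` costs `d`, and rounding the projection costs another `d`.
  -- So points with equal `g` have projections within `4 * d`.
  set g : Euc d → Euc d := fun z => floorVec (orthProj V (a z)) with hg
  have hza : ∀ z ∈ F, ‖z - a z‖ ≤ d := by
    intro z hz
    have := norm_sub_floorVec_le (a z)
    rwa [(ha z hz).2, norm_sub_rev] at this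
  have hgp : ∀ z ∈ F, ‖orthProj V z - g z‖ ≤ 2 * d := by
    intro z hz
    have h1 : ‖orthProj V z - orthProj V (a z)‖ ≤ d := by
      rw [← map_sub]
      exact (norm_orthProj_le V _).trans (hza z hz)
    have h2 : ‖orthProj V (a z) - g z‖ ≤ d := norm_sub_floorVec_le _
    have := norm_add_le (orthProj V z - orthProj V (a z)) (orthProj V (a z) - g z)
    rw [sub_add_sub_cancel] at this
    linarith
  refine ⟨(F.image g).card, ?_, ?_⟩
  · rw [← cnt_coe_finset]
    refine cnt_mono fun w hw => ?_
    rw [Finset.mem_coe, Finset.mem_image] at hw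
    obtain ⟨z, hz, rfl⟩ := hw
    refine ⟨⟨_, ⟨a z, (ha z hz).1, rfl⟩, rfl⟩, fun i => ?_⟩
    have h1 := norm_le_of_mem_centeredCube (hFQ z hz)
    have h2 := norm_orthProj_le V z
    have h3 := hgp z hz
    have h4 : ‖g z‖ ≤ ‖orthProj V z‖ + ‖orthProj V z - g z‖ := by
      rw [norm_sub_rev]
      simpa using norm_add_le (orthProj V z) (g z - orthProj V z)
    have h5 : |g z i| ≤ ‖g z‖ := PiLp.norm_apply_le (g z) i
    have h6 : (d : ℝ) ≤ d * ℓ := le_mul_of_one_le_right (by positivity) hℓ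
    have h7 : |g z i| < (3 * d + 1) * ℓ := by linarith
    rw [abs_lt] at h7
    exact ⟨h7.1.le, h7.2⟩
  · have h1 : (F.card : ℝ) ^ 2 ≤ (F.image g).card *
        ∑ z ∈ F, ((F.filter fun w => g w = g z).card : ℝ) := by
      exact_mod_cast card_sq_le_card_image_mul F g
    refine h1.trans (mul_le_mul_of_nonneg_left (Finset.sum_le_sum fun x hx => ?_) (by positivity))
    refine Nat.cast_le.mpr (Finset.card_le_card fun z hz => ?_)
    rw [Finset.mem_filter] at hz ⊢
    refine ⟨hz.1, ?_⟩
    have h2 := hgp z hz.1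
    have h3 := hgp x hx
    rw [hz.2, norm_sub_rev] at *
    rw [map_sub]
    have := norm_sub_le (orthProj V z - g x) (orthProj V x - g x)
    rw [sub_sub_sub_cancel_right] at this
    rw [norm_sub_rev (orthProj V x)] at this
    rw [norm_sub_rev] at this
    linarith [norm_sub_rev (orthProj V z) (orthProj V x), norm_sub_rev (g x) (orthProj V z),
      norm_sub_rev (g x) (orthProj V x)]

/-- Outside the Markov event there are at most `K * E * ℓ ^ max (s - k) 0` collisions per point on
average, and Cauchy–Schwarz divides the number of points by this. `E` is independent of the scale
and of `K`. -/
lemma grassmannMeasure_cnt_floorSet_orthProj_lt_le {d k : ℕ} (hk : k ≤ d) (A : Set (Euc d))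
    {C s : ℝ} (hC : 0 < C) (hsk : s ≠ k)
    (hA : ∀ (a : Euc d) (ℓ : ℝ), 1 ≤ ℓ →
      cnt (floorSet A ∩ cube a ℓ) ≤ ENNReal.ofReal (C * ℓ ^ s)) :
    ∃ E : ℝ, 0 < E ∧ ∀ (c β K ℓ : ℝ), 0 < c → 0 < K → 1 ≤ ℓ →
      ENNReal.ofReal (c * ℓ ^ β) ≤ cnt (floorSet A ∩ centeredCube d ℓ) →
      grassmannMeasure d k hk {V | cnt (floorSet (orthProj V '' A) ∩
          centeredCube d ((3 * d + 1) * ℓ)) <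
        ENNReal.ofReal (c / (K * E) * ℓ ^ (β - max (s - k) 0))} ≤ ENNReal.ofReal (1 / K) := by
  classical
  obtain ⟨E, hE, hsum⟩ := exists_sum_grassmannMeasure_sub_le d k hk (ρ := 4 * d) (by positivity)
    A hC hsk hA
  refine ⟨E, hE, fun c β K ℓ hc hK hℓ hlow => ?_⟩
  have hfin : (floorSet A ∩ centeredCube d ℓ).Finite := by
    have h1 := (cnt_centeredCube_le A hℓ).trans_lt ENNReal.ofReal_lt_top
    unfold cnt at h1
    rw [ENat.toENNReal_lt_top] at h1
    exact Set.encard_lt_top_iff.mp h1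
  set F := hfin.toFinset with hF
  have hFc : (F : Set (Euc d)) = floorSet A ∩ centeredCube d ℓ := hfin.coe_toFinset
  have hFA : (F : Set (Euc d)) ⊆ floorSet A := by rw [hFc]; exact Set.inter_subset_left
  have hFQ : ∀ z ∈ F, z ∈ centeredCube d ℓ := fun z hz => (hfin.mem_toFinset.mp hz).2
  have hℓ0 : 0 < ℓ := by linarith
  have hMpos : 0 < E * ℓ ^ max (s - k) 0 := by positivity
  rw [← hFc, cnt_coe_finset, ← ENNReal.ofReal_natCast,
    ENNReal.ofReal_le_ofReal_iff (by positivity)] at hlow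
  have hcard : (0 : ℝ) < F.card := lt_of_lt_of_le (by positivity) hlow
  have h := grassmannMeasure_le_sum_card_filter_le hk
    (Finset.card_pos.mp (by exact_mod_cast hcard))
    (fun x hx => hsum ℓ F x hℓ hFA hFQ hx) hK hMpos
  refine (measure_mono fun V hV => ?_).trans h
  by_contra hcon
  rw [Set.mem_ofPred_eq, not_le] at hcon
  obtain ⟨D, hD1, hD2⟩ := card_sq_le_cnt_floorSet_orthProj V A F hℓ hFA hFQ
  have h1 := hD1.trans_lt hV
  rw [← ENNReal.ofReal_natCast, ENNReal.ofReal_lt_ofReal_iff (by positivity)] at h1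
  set e := max (s - (k : ℝ)) 0 with he
  have h2 : (F.card : ℝ) ^ 2 ≤ D * (K * (F.card * (E * ℓ ^ e))) :=
    hD2.trans (mul_le_mul_of_nonneg_left hcon.le (by positivity))
  have h3 : (F.card : ℝ) ≤ D * (K * (E * ℓ ^ e)) := by
    have : (F.card : ℝ) * F.card ≤ F.card * (D * (K * (E * ℓ ^ e))) := by
      rw [← sq]; refine h2.trans (le_of_eq (by ring))
    exact le_of_mul_le_mul_left this hcard
  have h4 : D * (K * (E * ℓ ^ e)) < c / (K * E) * ℓ ^ (β - e) * (K * (E * ℓ ^ e)) :=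
    mul_lt_mul_of_pos_right h1 (by positivity)
  have h5 : c / (K * E) * ℓ ^ (β - e) * (K * (E * ℓ ^ e)) = c * ℓ ^ β := by
    rw [Real.rpow_sub hℓ0]
    field_simp
  linarith

/-- If `A` has counting growth at most `ℓ ^ s` with `s ≠ k`, and mass growth at least `ℓ ^ β`
along a sequence, then almost every projection has mass growth at least
`ℓ ^ (β - max (s - k) 0)` along a sequence. -/
theorem ae_massMeas_orthProj_pos {d k : ℕ} (hk : k ≤ d) (A : Set (Euc d))
    {C s c β : ℝ} (hC : 0 < C) (hsk : s ≠ k)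
    (hA : ∀ (a : Euc d) (ℓ : ℝ), 1 ≤ ℓ →
      cnt (floorSet A ∩ cube a ℓ) ≤ ENNReal.ofReal (C * ℓ ^ s)) (hc : 0 < c)
    (hlow : ∃ᶠ ℓ : ℝ in atTop,
      ENNReal.ofReal (c * ℓ ^ β) ≤ cnt (floorSet A ∩ centeredCube d ℓ)) :
    ∀ᵐ V ∂(grassmannMeasure d k hk),
      0 < massMeas (β - max (s - k) 0) (orthProj V '' A) := by
  obtain ⟨E, hE, hprob⟩ := grassmannMeasure_cnt_floorSet_orthProj_lt_le hk A hC hsk hA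
  set γ := β - max (s - k) 0 with hγ
  rw [ae_iff]
  refine le_antisymm ?_ zero_le
  have key : ∀ K : ℝ, 0 < K → grassmannMeasure d k hk
      {V | ¬ 0 < massMeas γ (orthProj V '' A)} ≤ ENNReal.ofReal (1 / K) := by
    intro K hK
    set bad : ℝ → Set (Grassmannian d k) := fun ℓ => {V | cnt (floorSet (orthProj V '' A) ∩
      centeredCube d ((3 * d + 1) * ℓ)) < ENNReal.ofReal (c / (K * E) * ℓ ^ γ)} with hbad
    -- If the mass measure vanishes, all large scales are bad. Each `T m` sits inside the bad event
    -- of a single scale allowed by `hlow`, and continuity along the increasing union keeps the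
    -- bound `1 / K`.
    set T : ℕ → Set (Grassmannian d k) := fun m => {V | ∀ ℓ : ℝ, m ≤ ℓ → V ∈ bad ℓ} with hT
    have hmono : Monotone T := by
      intro m n hmn V hV ℓ hℓ
      exact hV ℓ (le_trans (by exact_mod_cast hmn) hℓ)
    have hTle : ∀ m, grassmannMeasure d k hk (T m) ≤ ENNReal.ofReal (1 / K) := by
      intro m
      obtain ⟨ℓ, hℓ, hm, h1⟩ := (hlow.and_eventually
        ((eventually_ge_atTop (m : ℝ)).and (eventually_ge_atTop 1))).exists
      have hTb : T m ⊆ bad ℓ := fun V hV => hV ℓ hm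
      exact (measure_mono hTb).trans (hprob c β K ℓ hc hK h1 hℓ)
    have hsub : {V | ¬ 0 < massMeas γ (orthProj V '' A)} ⊆ ⋃ m, T m := by
      intro V hV
      rw [Set.mem_ofPred_eq, not_lt, nonpos_iff_eq_zero] at hV
      set M : ℝ := 3 * d + 1 with hM
      have hMpos : 0 < M := by positivity
      -- This `δ` cancels the factor `(2 * M) ^ γ` coming from the enlarged cube.
      have h1 := eventually_lt_of_massMeas_eq_zero hV
        (δ := c / (K * E) / (2 * M) ^ γ) (by positivity)
      have h2 : Tendsto (fun ℓ : ℝ => M * ℓ) atTop atTop := tendsto_id.const_mul_atTop hMpos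
      obtain ⟨L, hL⟩ := eventually_atTop.mp ((h2.eventually h1).and (eventually_gt_atTop 0))
      obtain ⟨m, hm⟩ := exists_nat_ge L
      refine Set.mem_iUnion.mpr ⟨m, fun ℓ hℓ => ?_⟩
      obtain ⟨h3, h4⟩ := hL ℓ (hm.trans hℓ)
      refine h3.trans_le (ENNReal.ofReal_le_ofReal (le_of_eq ?_))
      rw [← mul_assoc 2 M, Real.mul_rpow (by positivity) h4.le]
      field_simp
    refine (measure_mono hsub).trans ?_
    rw [hmono.directed_le.measure_iUnion]
    exact iSup_le hTle
  have hlim : Tendsto (fun K : ℝ => ENNReal.ofReal (1 / K)) atTop (nhds 0) := by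
    have := ENNReal.tendsto_ofReal (tendsto_inv_atTop_zero (𝕜 := ℝ))
    simpa using this
  refine ge_of_tendsto hlim ?_
  filter_upwards [eventually_gt_atTop 0] with K hK using key K hK

/-! ## Upper bound for the mass of random projections -/

lemma tsum_indicator_eq_cnt {X : Type*} (Z : Set X) (p : X → Prop) :
    ∑' z : Z, {z | p z}.indicator (fun _ => (1 : ℝ≥0∞)) (z : X) = cnt {z ∈ Z | p z} := by
  rw [tsum_subtype Z, cnt, ← ENNReal.tsum_set_one, tsum_subtype _ fun _ => (1 : ℝ≥0∞)]
  refine tsum_congr fun z => ?_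
  rw [Set.indicator_indicator]
  rfl

/-- For a set of growth exponent `s < k`, the expected number of points projected into a ball of
radius `ρ t` is `O(t ^ s)`. -/
lemma exists_tsum_grassmannMeasure_le {d k : ℕ} (hk : k ≤ d) {ρ : ℝ} (hρ : 0 ≤ ρ)
    (A : Set (Euc d)) {C s : ℝ} (hC : 0 < C) (hsk : s < k)
    (hA : ∀ (a : Euc d) (ℓ : ℝ), 1 ≤ ℓ →
      cnt (floorSet A ∩ cube a ℓ) ≤ ENNReal.ofReal (C * ℓ ^ s)) :
    ∃ E : ℝ, 0 < E ∧ ∀ t : ℝ, 1 ≤ t →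
      ∑' z : floorSet A, grassmannMeasure d k hk {V | ‖orthProj V (z : Euc d)‖ ≤ ρ * t} ≤
        ENNReal.ofReal (E * t ^ s) := by
  classical
  obtain ⟨C₁, hC₁, hsum⟩ := exists_sum_grassmannMeasure_le d k hk hρ
  set q : ℝ := 2 ^ (s - k) with hq
  have hq0 : 0 < q := by positivity
  have hq1 : q < 1 := Real.rpow_lt_one_of_one_lt_of_neg one_lt_two (by linarith)
  have hq2 : 0 < 1 - q := by linarith
  refine ⟨C₁ * (C * (3 : ℝ) ^ s) * (1 / (1 - q)), by positivity, fun t ht => ?_⟩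
  have ht0 : 0 < t := by linarith
  rw [ENNReal.tsum_eq_iSup_sum]
  refine iSup_le fun F' => ?_
  set F : Finset (Euc d) := F'.map (Function.Embedding.subtype _) with hF
  have hFA : (F : Set (Euc d)) ⊆ floorSet A := by
    intro z hz
    rw [Finset.mem_coe, hF, Finset.mem_map] at hz
    obtain ⟨y, -, rfl⟩ := hz
    exact y.2
  have hsumF : ∑ z ∈ F', grassmannMeasure d k hk {V | ‖orthProj V (z : Euc d)‖ ≤ ρ * t} =
      ENNReal.ofReal (∑ z ∈ F,
        (grassmannMeasure d k hk).real {V | ‖orthProj V (z - 0)‖ ≤ ρ * t}) := by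
    rw [ENNReal.ofReal_sum_of_nonneg fun z _ => measureReal_nonneg, hF, Finset.sum_map]
    exact Finset.sum_congr rfl fun z _ => by simp
  rw [hsumF]
  refine ENNReal.ofReal_le_ofReal ?_
  -- `m` depends on the finite set, but the geometric sum is bounded independently of it because `q
  -- < 1`.
  obtain ⟨m, hm⟩ : ∃ m : ℕ, ∀ z ∈ F, ‖z - 0‖ < 2 ^ m * t := by
    obtain ⟨m, hm⟩ := pow_unbounded_of_one_lt (∑ z ∈ F, ‖z‖) one_lt_two
    refine ⟨m, fun z hz => ?_⟩
    have h1 : ‖z‖ ≤ ∑ z ∈ F, ‖z‖ :=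
      Finset.single_le_sum (f := fun z : Euc d => ‖z‖) (fun _ _ => norm_nonneg _) hz
    have h2 : (2 : ℝ) ^ m ≤ 2 ^ m * t := le_mul_of_one_le_right (by positivity) ht
    rw [sub_zero]
    linarith
  have := hsum 0 F t (C * (3 : ℝ) ^ s * t ^ s) s m ht0 (by positivity) ?_
  · rw [Finset.filter_true_of_mem hm] at this
    refine this.trans ?_
    have h3 := geom_sum_le_of_lt_one hq0.le hq1 (m + 1)
    calc C₁ * (C * 3 ^ s * t ^ s) * ∑ i ∈ Finset.range (m + 1), q ^ i
        ≤ C₁ * (C * 3 ^ s * t ^ s) * (1 / (1 - q)) := by gcongr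
      _ = _ := by ring
  · intro i _
    have h2 : (1 : ℝ) ≤ 2 ^ i := one_le_pow₀ one_le_two
    have h4 : 1 ≤ 2 ^ i * t := one_le_mul_of_one_le_of_one_le h2 ht
    have h1 : ((F.filter fun z => ‖z - 0‖ < 2 ^ i * t : Finset (Euc d)) : Set (Euc d)) ⊆
        floorSet A ∩ cube (WithLp.toLp 2 fun _ => -((2 : ℝ) ^ i * t)) (3 * (2 ^ i * t)) := by
      intro z hz
      rw [Finset.mem_coe, Finset.mem_filter, sub_zero] at hz
      refine ⟨hFA hz.1, fun j => ?_⟩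
      have h5 : |z j| < 2 ^ i * t := (PiLp.norm_apply_le z j).trans_lt hz.2
      rw [abs_lt] at h5
      constructor
      · exact h5.1.le
      · change z j < -((2 : ℝ) ^ i * t) + 3 * (2 ^ i * t)
        linarith
    have h3 := (cnt_mono h1).trans (hA _ _ (by linarith))
    rw [cnt_coe_finset, ← ENNReal.ofReal_natCast,
      ENNReal.ofReal_le_ofReal_iff (by positivity)] at h3
    refine h3.trans (le_of_eq ?_)
    rw [Real.mul_rpow (by norm_num) (by positivity), Real.mul_rpow (by positivity) ht0.le,
      ← Real.rpow_natCast_mul two_pos.le, ← Real.rpow_mul_natCast two_pos.le, mul_comm (i : ℝ) s]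
    ring

/-- The integer points of a projection are controlled by the integer points projected to a ball. -/
lemma cnt_floorSet_orthProj_le {d k : ℕ} (V : Grassmannian d k) (A : Set (Euc d)) {ℓ r : ℝ}
    (hℓ : 1 ≤ ℓ) (hr : ℓ ≤ r) :
    cnt (floorSet (orthProj V '' A) ∩ centeredCube d ℓ) ≤
      ENNReal.ofReal ((2 * (2 * d) + 2) ^ d) *
        cnt {z ∈ floorSet A | ‖orthProj V z‖ ≤ 3 * d * r} := by
  refine cnt_le_of_forall_exists_norm_sub_le
    (Set.inter_subset_left.trans (floorSet_subset_intPoints _)) _ (fun z => orthProj V z)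
    (by positivity) ?_
  rintro _ ⟨⟨_, ⟨a, ha, rfl⟩, rfl⟩, hw⟩
  have h1 := norm_le_of_mem_centeredCube hw
  have h2 : ‖orthProj V a - floorVec (orthProj V a)‖ ≤ d := norm_sub_floorVec_le _
  have h3 : ‖orthProj V a - orthProj V (floorVec a)‖ ≤ d := by
    rw [← map_sub]
    exact (norm_orthProj_le V _).trans (norm_sub_floorVec_le a)
  have h4 : ‖floorVec (orthProj V a) - orthProj V (floorVec a)‖ ≤ 2 * d := by
    have := norm_add_le (floorVec (orthProj V a) - orthProj V a)
      (orthProj V a - orthProj V (floorVec a))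
    rw [sub_add_sub_cancel, norm_sub_rev _ (orthProj V a)] at this
    linarith
  refine ⟨floorVec a, ⟨⟨a, ha, rfl⟩, ?_⟩, h4⟩
  have h5 := norm_add_le (orthProj V (floorVec a) - floorVec (orthProj V a))
    (floorVec (orthProj V a))
  rw [sub_add_cancel, norm_sub_rev] at h5
  have h6 : (d : ℝ) ≤ d * ℓ := le_mul_of_one_le_right (by positivity) hℓ
  have h7 : (d : ℝ) * ℓ ≤ d * r := mul_le_mul_of_nonneg_left hr (by positivity)
  linarith

/-- If `A` has counting growth at most `ℓ ^ s` with `s < k`, then almost every projection has mass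
dimension at most `s' > s`. -/
theorem ae_massDim_orthProj_le {d k : ℕ} (hk : k ≤ d) (A : Set (Euc d))
    {C s s' : ℝ} (hC : 0 < C) (hsk : s < k) (hs' : 0 ≤ s') (hss' : s < s')
    (hA : ∀ (a : Euc d) (ℓ : ℝ), 1 ≤ ℓ →
      cnt (floorSet A ∩ cube a ℓ) ≤ ENNReal.ofReal (C * ℓ ^ s)) :
    ∀ᵐ V ∂(grassmannMeasure d k hk), massDim (orthProj V '' A) ≤ s' := by
  obtain ⟨E, hE, hsum⟩ := exists_tsum_grassmannMeasure_le hk (ρ := 3 * d) (by positivity) A hC hsk hA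
  have hcount : Countable (floorSet A) :=
    ((countable_intPoints d).mono (floorSet_subset_intPoints A)).to_subtype
  set μ := grassmannMeasure d k hk
  set S : ℕ → Euc d → Set (Grassmannian d k) :=
    fun j z => {V | ‖orthProj V z‖ ≤ 3 * d * 2 ^ j} with hS
  have hSm : ∀ j z, MeasurableSet (S j z) := fun j z =>
    (isClosed_norm_orthProj_le z _).measurableSet
  set f : ℕ → Grassmannian d k → ℝ≥0∞ := fun j V =>
    ∑' z : floorSet A, (S j z).indicator (fun _ => (1 : ℝ≥0∞)) V with hf
  have hfm : ∀ j, Measurable (f j) := fun j =>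
    Measurable.tsum fun z => measurable_const.indicator (hSm j z)
  have hfcnt : ∀ j V, f j V = cnt {z ∈ floorSet A | ‖orthProj V z‖ ≤ 3 * d * 2 ^ j} :=
    fun j V => tsum_indicator_eq_cnt (floorSet A) fun z => ‖orthProj V z‖ ≤ 3 * d * 2 ^ j
  have hfint : ∀ j, ∫⁻ V, f j V ∂μ ≤ ENNReal.ofReal (E * (2 ^ j) ^ s) := by
    intro j
    rw [lintegral_tsum fun z : floorSet A =>
      (measurable_const.indicator (hSm j z)).aemeasurable]
    simp only [lintegral_indicator_const (hSm j _), one_mul]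
    exact hsum (2 ^ j) (one_le_pow₀ one_le_two)
  set w : ℕ → ℝ≥0∞ := fun j => ENNReal.ofReal (((2 : ℝ) ^ j) ^ (-s')) with hw
  set G : Grassmannian d k → ℝ≥0∞ := fun V => ∑' j, w j * f j V with hG
  have hGm : Measurable G := Measurable.tsum fun j => (hfm j).const_mul _
  have hGint : ∫⁻ V, G V ∂μ ≠ ⊤ := by
    rw [lintegral_tsum fun j => ((hfm j).const_mul _).aemeasurable]
    have h1 : ∀ j, ∫⁻ V, w j * f j V ∂μ ≤ ENNReal.ofReal (E * ((2 : ℝ) ^ (s - s')) ^ j) := by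
      intro j
      rw [lintegral_const_mul _ (hfm j)]
      refine (mul_le_mul_right (hfint j) _).trans (le_of_eq ?_)
      rw [← ENNReal.ofReal_mul (by positivity)]
      congr 1
      rw [← Real.rpow_mul_natCast two_pos.le, mul_comm (s - s'), Real.rpow_natCast_mul two_pos.le,
        sub_eq_add_neg, Real.rpow_add (by positivity)]
      ring
    have h2 : Summable fun j : ℕ => E * ((2 : ℝ) ^ (s - s')) ^ j :=
      (summable_geometric_of_lt_one (by positivity)
        (Real.rpow_lt_one_of_one_lt_of_neg one_lt_two (by linarith))).mul_left E
    refine ((ENNReal.tsum_le_tsum h1).trans_lt ?_).ne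
    rw [← ENNReal.ofReal_tsum_of_nonneg (fun j => by positivity) h2]
    exact ENNReal.ofReal_lt_top
  filter_upwards [ae_lt_top hGm hGint] with V hV
  refine massDim_le_of_le (C := (2 * (2 * d) + 2) ^ d * ((G V).toReal * 2 ^ s')) hs' ?_
  filter_upwards [eventually_ge_atTop 1] with ℓ hℓ
  -- Bounding the single term `n + 1` of the series by `G V` controls the count at every scale `ℓ <
  -- 2 ^ (n + 1) ≤ 2 * ℓ`.
  obtain ⟨n, hn1, hn2⟩ := exists_nat_pow_near hℓ one_lt_two
  refine (cnt_floorSet_orthProj_le V A hℓ hn2.le).trans ?_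
  rw [← hfcnt, mul_assoc, ENNReal.ofReal_mul (by positivity)]
  refine mul_le_mul_right ?_ _
  have h3 : w (n + 1) * f (n + 1) V ≤ G V := ENNReal.le_tsum (n + 1)
  have hpos : (0 : ℝ) < ((2 : ℝ) ^ (n + 1)) ^ s' := by positivity
  have h4 : w (n + 1) = (ENNReal.ofReal (((2 : ℝ) ^ (n + 1)) ^ s'))⁻¹ := by
    simp only [hw]
    rw [Real.rpow_neg (by positivity), ENNReal.ofReal_inv_of_pos hpos]
  rw [h4, mul_comm, ← div_eq_mul_inv,
    ENNReal.div_le_iff (by simpa using hpos) ENNReal.ofReal_ne_top] at h3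
  refine h3.trans ?_
  rw [← ENNReal.ofReal_toReal hV.ne, ← ENNReal.ofReal_mul ENNReal.toReal_nonneg,
    ENNReal.toReal_ofReal ENNReal.toReal_nonneg, mul_assoc,
    ← Real.mul_rpow two_pos.le (by linarith)]
  refine ENNReal.ofReal_le_ofReal (mul_le_mul_of_nonneg_left ?_ ENNReal.toReal_nonneg)
  refine Real.rpow_le_rpow (by positivity) ?_ hs'
  rw [pow_succ]
  linarith

/-! ## Mass dimension of almost every projection -/

lemma massDim_orthProj_le_natCast {d k : ℕ} (V : Grassmannian d k) (A : Set (Euc d)) :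
    massDim (orthProj V '' A) ≤ k := by
  obtain ⟨C, hC⟩ := exists_cnt_floorSet_orthProj_le d k
  refine massDim_le_of_le (C := C) (by positivity) ?_
  filter_upwards [eventually_ge_atTop 1] with ℓ hℓ using hC V A ℓ hℓ

/-- Restricting to rational exponents keeps the union of exceptional null sets countable. -/
lemma ae_massDim_orthProj_le_massDim {d k : ℕ} (hk : k ≤ d) (A : Set (Euc d))
    (hA : countingDim A = massDim A) :
    ∀ᵐ V ∂(grassmannMeasure d k hk), massDim (orthProj V '' A) ≤ min (k : ℝ) (massDim A) := by
  have h : ∀ q : ℚ, ∀ᵐ V ∂(grassmannMeasure d k hk), massDim A < q → (q : ℝ) < k →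
      massDim (orthProj V '' A) ≤ q := by
    intro q
    by_cases hq : massDim A < q ∧ (q : ℝ) < k
    · obtain ⟨C, hC, hb⟩ := exists_cnt_cube_le_of_countingDim_lt (A := A)
        (s := (massDim A + q) / 2) (by linarith [hq.1])
      filter_upwards [ae_massDim_orthProj_le hk A (s' := q) hC (by linarith [hq.1, hq.2])
        (by linarith [massDim_nonneg A, hq.1]) (by linarith [hq.1]) hb] with V hV _ _ using hV
    · exact Eventually.of_forall fun V h1 h2 => absurd ⟨h1, h2⟩ hq
  filter_upwards [ae_all_iff.mpr h] with V hV
  refine le_min (massDim_orthProj_le_natCast V A) ?_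
  rcases le_or_gt (k : ℝ) (massDim A) with h1 | h1
  · exact (massDim_orthProj_le_natCast V A).trans h1
  · refine le_of_forall_gt_imp_ge_of_dense fun t ht => ?_
    obtain ⟨q, hq1, hq2⟩ := exists_rat_btwn (lt_min ht h1)
    exact (hV q hq1 (hq2.trans_le (min_le_right _ _))).trans (hq2.le.trans (min_le_left _ _))

/-- Take `s = α + q` and `β = α - q`: the resulting exponent is `min (α - q) (k - 2 * q)`, and `q →
0` through rationals. -/
lemma ae_min_le_massDim_orthProj {d k : ℕ} (hk : k ≤ d) (A : Set (Euc d))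
    (hA : countingDim A = massDim A) :
    ∀ᵐ V ∂(grassmannMeasure d k hk), min (k : ℝ) (massDim A) ≤ massDim (orthProj V '' A) := by
  set α := massDim A with hα
  have h : ∀ q : ℚ, ∀ᵐ V ∂(grassmannMeasure d k hk), (0 : ℝ) < q → (q : ℝ) ≤ α → α + q ≠ k →
      min (k : ℝ) α - 2 * q ≤ massDim (orthProj V '' A) := by
    intro q
    by_cases hq : (0 : ℝ) < q ∧ (q : ℝ) ≤ α ∧ α + q ≠ k
    · obtain ⟨h1, h2, h3⟩ := hq
      obtain ⟨C, hC, hb⟩ := exists_cnt_cube_le_of_countingDim_lt (A := A)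
        (s := α + q) (by linarith)
      obtain ⟨c, hc, hfreq⟩ := exists_frequently_of_massMeas_pos
        (massMeas_pos_of_lt_massDim (B := A) (β := α - q) (by linarith) (by linarith))
      filter_upwards [ae_massMeas_orthProj_pos hk A hC h3 hb hc hfreq] with V hV _ _ _
      refine le_trans ?_ (le_massDim_of_massMeas_pos hV)
      have h4 := min_le_left (k : ℝ) α
      have h5 := min_le_right (k : ℝ) α
      rcases max_cases (α + q - (k : ℝ)) 0 with h6 | h6 <;> linarith [h6.1]
    · exact Eventually.of_forall fun V h1 h2 h3 => absurd ⟨h1, h2, h3⟩ hq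
  filter_upwards [ae_all_iff.mpr h] with V hV
  refine le_of_forall_lt_imp_le_of_dense fun t ht => ?_
  rcases lt_or_ge t 0 with ht0 | ht0
  · exact ht0.le.trans (massDim_nonneg _)
  have h5 := min_le_right (k : ℝ) α
  obtain ⟨q, hq1, hq2⟩ := exists_rat_btwn (show (0 : ℝ) < (min (k : ℝ) α - t) / 2 by linarith)
  -- The critical exponent `s = k` is avoided by halving `q`.
  by_cases hq : α + q = k
  · have h6 := hV (q / 2) (by push_cast; linarith) (by push_cast; linarith)
      (by push_cast; intro h7; linarith)
    push_cast at h6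
    linarith
  · have h6 := hV q hq1 (by linarith) hq
    linarith

/-- Finite counting measure and positive mass measure allow `s = β = massDim A` with no loss in the
exponent. -/
lemma ae_massMeas_orthProj_pos_of_regular {d k : ℕ} (hk : k ≤ d) (A : Set (Euc d))
    (hA : countingDim A = massDim A) (hc : IsCountingRegular A) (hm : IsMassRegular A)
    (hne : massDim A ≠ k) :
    ∀ᵐ V ∂(grassmannMeasure d k hk),
      0 < massMeas (min (k : ℝ) (massDim A)) (orthProj V '' A) := by
  obtain ⟨C, hC, hb⟩ := exists_cnt_cube_le_of_countingMeas_lt_top (A := A) (massDim_nonneg A)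
    (hA ▸ hc.2)
  obtain ⟨c, hc', hfreq⟩ := exists_frequently_of_massMeas_pos hm.1
  have hmin : massDim A - max (massDim A - (k : ℝ)) 0 = min (k : ℝ) (massDim A) := by
    rcases le_total (massDim A) k with h | h
    · rw [max_eq_right (by linarith), min_eq_right h, sub_zero]
    · rw [max_eq_left (by linarith), min_eq_left h, sub_sub_cancel]
  rw [← hmin]
  exact ae_massMeas_orthProj_pos hk A hC hne hb hc' hfreq

end Marstrand

theorem corollaryE (d k : ℕ) (hk : k ≤ d) (A : Set (Marstrand.Euc d))
    (hA : Marstrand.countingDim A = Marstrand.massDim A) :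
    ∀ᵐ V ∂(Marstrand.grassmannMeasure d k hk),
      Marstrand.massDim (Marstrand.orthProj V '' A) = min (k : ℝ) (Marstrand.massDim A) ∧
      (Marstrand.IsCountingRegular A → Marstrand.IsMassRegular A →
        Marstrand.massDim A ≠ (k : ℝ) →
        0 < Marstrand.massMeas (min (k : ℝ) (Marstrand.massDim A))
          (Marstrand.orthProj V '' A)) := by
  refine Eventually.and ?_ ?_
  · filter_upwards [Marstrand.ae_massDim_orthProj_le_massDim hk A hA,
      Marstrand.ae_min_le_massDim_orthProj hk A hA] with V h1 h2 using le_antisymm h1 h2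
  · by_cases h : Marstrand.IsCountingRegular A ∧ Marstrand.IsMassRegular A ∧
        Marstrand.massDim A ≠ (k : ℝ)
    · filter_upwards [Marstrand.ae_massMeas_orthProj_pos_of_regular hk A hA h.1 h.2.1 h.2.2]
        with V hV _ _ _ using hV
    · exact Eventually.of_forall fun V h1 h2 h3 => absurd ⟨h1, h2, h3⟩ h
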